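/- **Double gamma functions.** For $\tau>0$ let $G(z;\tau)$ be Barnes' double gamma function, the entire function $$G(z;\tau)=\frac z\tau\, e^{a(\tau)\frac z\tau+b(\tau)\frac{z^2}{2\tau^2}}\prod_{\substack{k,l\ge 0\\(k,l)\ne(0,0)}}\Big(1+\frac z{k\tau+l}\Big)e^{-\frac z{k\tau+l}+\frac{z^2}{2(k\tau+l)^2}},$$ $$a(\tau)=\gamma\tau+\tfrac\tau2\ln(2\pi\tau)+\tfrac12\ln\tau-\tau C(\tau),\qquad b(\tau)=-\tfrac{\pi^2\tau^2}6-\tau\ln\tau-\tau^2D(\tau),$$ where $\gamma$ is Euler's constant, $\psi=\Gamma'/\Gamma$, and $$C(\tau)=\lim_{M\to\infty}\Big[\sum_{k=1}^{M-1}\psi(k\tau)+\tfrac12\psi(M\tau)-\tfrac1\tau\ln\frac{\Gamma(M\tau)}{\sqrt{2\pi}}\Big],\quad D(\tau)=\lim_{M\to\infty}\Big[\sum_{k=1}^{M-1}\psi'(k\tau)+\tfrac12\psi'(M\tau)-\tfrac1\tau\psi(M\tau)\Big].$$ (Thus $G(1;\tau)=1$ and $G(z+1;\tau)=\Gamma(z/\tau)G(z;\tau)$.)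 For $\omega_1,\omega_2>0$, $\boldsymbol\omega=(\omega_1,\omega_2)$, let $$\Gamma_2(z;\boldsymbol\omega)=\exp\Big(\partial_s\sum_{k,l\ge0}(z+k\omega_1+l\omega_2)^{-s}\Big|_{s=0}-\partial_s\sum_{\substack{k,l\ge 0\\(k,l)\neq(0,0)}}(k\omega_1+l\omega_2)^{-s}\Big|_{s=0}\Big)$$ (both sums analytically continued from $\mathrm{Re}\,s>2$) be the symmetric double gamma function, normalized by $\Gamma_2(\omega_1;\boldsymbol\omega)=\sqrt{2\pi/\omega_2}$. **The $K$-function.** Let $0\le m\le q$, $0\le n\le p$ be integers, $\mathbf a\in\mathbb C^p$, $\mathbf b\in\mathbb C^q$, $\alpha\in\mathbb C$, $N=2(m+n)-p-q$, $\nu=\sum_{j=1}^p a_j-\sum_{j=1}^q b_j$, $$\mu=\sum_{j\le n}a_j-\sum_{j>n}a_j+\sum_{j\le m}b_j-\sum_{j>m}b_j,\qquad \xi=\sum_{j\le n}a_j^2-\sum_{j>n}a_j^2+\sum_{j\le m}b_j^2-\sum_{j>m}b_j^2,$$ $\Lambda^+=\{a_j+l\tau+k: j>n,\ l,k\ge0\}$,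 $\Lambda^-=\{b_j-l\tau-k: j>m,\ l,k\ge1\}$, and assume $\Lambda^+\cap\Lambda^-=\emptyset$. Put $$K^{m,n}_{p,q}\Big({\mathbf a\atop\mathbf b}\Big|z;\tau,\alpha\Big)=\frac1{2\pi i}\int_\gamma\frac{\prod_{j=1}^mG(b_j-s;\tau)\prod_{j=1}^nG(1+\tau-a_j+s;\tau)}{\prod_{j=m+1}^qG(1+\tau-b_j+s;\tau)\prod_{j=n+1}^pG(a_j-s;\tau)}\,e^{\frac{\pi\alpha}\tau s^2}z^{-s}\,ds .$$ Here $\gamma$ is a simple piecewise smooth curve that comes from infinity in the lower half-plane along a ray of direction $e^{i\theta^-}$, $\theta^-\in(-\pi,0)$, goes to infinity in the upper half-plane along a ray of direction $e^{i\theta^+}$, $\theta^+\in(0,\pi)$, and divides the plane into two domains, one containing $\Lambda^+$ and all large positive numbers, the other containing $\Lambda^-$. The angles are any with - (i) if $N>0$: $\theta^+\in(\frac\pi4,\frac{3\pi}4)$, $\theta^-\in(-\frac{3\pi}4,-\frac\pi4)$; - (ii) if $N=0$, $\mathrm{Re}\,\alpha\ge0$, $4\alpha\ne\pm(p-q)i$: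 $\mathrm{Re}\big((\alpha\pm\frac{(p-q)i}4)e^{2i\theta^\pm}\big)<0$; - (iii) if $N=0$, $4\alpha=(q-p)i\ne0$, $\mu\ne0$, $\arg\mu\ne\frac\pi2$: $\mathrm{Re}(\mu e^{i\theta^+})>0$, $\mathrm{Re}(i(q-p)e^{2i\theta^-})<0$; - (iv) if $N=0$, $4\alpha=(p-q)i\ne0$, $\mu\ne0$, $\arg\mu\ne-\frac\pi2$: $\mathrm{Re}(i(p-q)e^{2i\theta^+})<0$, $\mathrm{Re}(\mu e^{i\theta^-})>0$; - (v) if $N=\alpha=p-q=0$, $\mathrm{Re}\,\mu\ne0$: $\mathrm{Re}(\mu e^{i\theta^\pm})>0$; - (vi) if $N=\alpha=p-q=\mu=0$, $\mathrm{Re}\,\nu<0$: $\theta^\pm=\pm\frac\pi2$; - (vii) if $N=\alpha=p-q=\mu=\nu=0$: for some $\varepsilon\in(0,\frac\pi2)$, $\theta^\pm=\pm\varepsilon$ when $z>1$ and $\theta^\pm=\pm(\pi-\varepsilon)$ when $0<z<1$. The parameters are *admissible* if one of these cases applies. The domain of $z$ is the Riemann surface of the logarithm in cases (i)–(v) (with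 $z^{-s}=e^{-s\ln z}$), the sector $|\arg z|<-\pi\,\mathrm{Re}\,\nu/(2\tau)$ in case (vi), and $(0,1)\cup(1,\infty)$ in case (vii). **Statement.** Let $\omega_1,\omega_2>0$ and let $m,n,p,q,\mathbf a,\mathbf b,\alpha$ be as above, with $N,\nu,\mu,\xi$ computed from them. Put $\tau=\omega_2/\omega_1$, $\eta=\alpha-N\ln(\omega_2)/(2\pi)$, $\tilde a_j=b_{q-j+1}/\omega_1$ $(1\le j\le q)$, $\tilde b_j=a_{p-j+1}/\omega_1$ $(1\le j\le p)$, $$C_1=(2\pi)^{\frac{(\omega_1+\omega_2)(m+n-q)-\nu}{2\omega_1}}\,\omega_2^{-N-\frac{\xi}{2\omega_1\omega_2}+\frac{\mu(\omega_1+\omega_2)}{2\omega_1\omega_2}}\,\omega_1,\qquad C_2=(2\pi)^{\frac{q-p}2}\,\omega_2^{\frac1{\omega_2}\left(\frac{N(\omega_1+\omega_2)}2-\mu\right)},$$ where powers and logarithms of the positive bases $2\pi$, $\omega_2$ use their real logarithms; in particular $\ln(C_2z^{\omega_1})=\frac{q-p}2\ln(2\pi)+\frac1{\omega_2}\big(\frac{N(\omega_1+\omega_2)}2-\mu\big)\ln\omega_2+\omega_1\ln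 z$. Assume that the parameters of $K^{p-n,q-m}_{q,p}(\tilde{\mathbf a};\tilde{\mathbf b}\,|\,\cdot\,;\tau,\eta)$ are admissible, with disjoint $\Lambda^+$ and $\Lambda^-$, and that $C_2z^{\omega_1}$ lies in its domain. Define $$\tilde K^{m,n}_{p,q}\Big({\mathbf a\atop\mathbf b}\Big|z;\boldsymbol\omega,\alpha\Big)=\frac1{2\pi i}\int_{\omega_1\gamma}\frac{\prod_{j=1}^m\Gamma_2(b_j-s;\boldsymbol\omega)\prod_{j=1}^n\Gamma_2(\omega_1+\omega_2-a_j+s;\boldsymbol\omega)}{\prod_{j=m+1}^q\Gamma_2(\omega_1+\omega_2-b_j+s;\boldsymbol\omega)\prod_{j=n+1}^p\Gamma_2(a_j-s;\boldsymbol\omega)}\,e^{\frac{\pi\alpha}{\omega_1\omega_2}s^2}z^{-s}\,ds,$$ where $\gamma$ is any contour for that $K$-function at the point $C_2z^{\omega_1}$. Then $$\tilde K^{m,n}_{p,q}\Big({\mathbf a\atop\mathbf b}\Big|z;\boldsymbol\omega,\alpha\Big)=C_1\,K^{p-n,q-m}_{q,p}\Big({\tilde a_1,\dots,\tilde a_q\atop\tilde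 b_1,\dots,\tilde b_p}\Big|C_2z^{\omega_1};\tau,\eta\Big).$$ Moreover, for each single contour $\gamma$ of this kind, the integral over $\omega_1\gamma$ converges absolutely if and only if the one over $\gamma$ does, and the first integral equals $C_1$ times the second one. -/

import Mathlib

open Filter MeasureTheory

noncomputable section

/-! ### Barnes' double gamma function `G(z; τ)`, `τ > 0` -/

/-- The digamma function `ψ = Γ'/Γ` on the real line. -/
def psiReal (x : ℝ) : ℝ := logDeriv Real.Gamma x

/-- The gamma modular form `C(τ)`. -/
def gammaModularC (τ : ℝ) : ℝ :=
  limUnder atTop fun M : ℕ =>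
    ∑ k ∈ Finset.Ico 1 M, psiReal (k * τ) + 1 / 2 * psiReal (M * τ)
      - 1 / τ * Real.log (Real.Gamma (M * τ) / Real.sqrt (2 * Real.pi))

/-- The gamma modular form `D(τ)`. -/
def gammaModularD (τ : ℝ) : ℝ :=
  limUnder atTop fun M : ℕ =>
    ∑ k ∈ Finset.Ico 1 M, deriv psiReal (k * τ) + 1 / 2 * deriv psiReal (M * τ)
      - 1 / τ * psiReal (M * τ)

/-- The linear coefficient in the Weierstrass product of `G(z; τ)`. -/
def barnesA (τ : ℝ) : ℝ :=
  Real.eulerMascheroniConstant * τ + τ / 2 * Real.log (2 * Real.pi * τ) + 1 / 2 * Real.log τ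
    - τ * gammaModularC τ

/-- The quadratic coefficient in the Weierstrass product of `G(z; τ)`. -/
def barnesB (τ : ℝ) : ℝ :=
  -(Real.pi ^ 2 * τ ^ 2 / 6) - τ * Real.log τ - τ ^ 2 * gammaModularD τ

/-- Barnes' double gamma function `G(z; τ)`, by its Weierstrass product over the pairs
`(k, l) ≠ (0, 0)` of natural numbers. It is entire in `z`, normalized by `G(1; τ) = 1`, and
satisfies `G(z + 1; τ) = Γ(z / τ) G(z; τ)`. -/
def barnesG (z : ℂ) (τ : ℝ) : ℂ :=
  z / τ * Complex.exp (barnesA τ * (z / τ) + barnesB τ * (z ^ 2 / (2 * τ ^ 2))) *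
    ∏' r : ℕ × ℕ,
      if r = (0, 0) then (1 : ℂ) else
        (1 + z / (r.1 * τ + r.2)) *
          Complex.exp (-(z / (r.1 * τ + r.2)) + z ^ 2 / (2 * (r.1 * τ + r.2) ^ 2))

/-! ### The symmetric double gamma function `Γ₂(z; ω₁, ω₂)`, `ω₁, ω₂ > 0` -/

/-- The region `Re s > -1`, `s ≠ 1, 2`, which is open, connected, and contains `0` and the
half-plane `Re s > 2`. -/
def continuationRegion : Set ℂ := {s | -1 < s.re ∧ s ≠ 1 ∧ s ≠ 2}

open Classical in
/-- The analytic continuation to `Re s > -1`, `s ≠ 1, 2`, of a function given on `Re s > 2`. -/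
def analyticContinuation (f : ℂ → ℂ) : ℂ → ℂ :=
  if h : ∃ F : ℂ → ℂ, DifferentiableOn ℂ F continuationRegion ∧ ∀ s : ℂ, 2 < s.re → F s = f s
  then Classical.choose h else 0

/-- Barnes' double zeta function `ζ₂(s; z | ω₁, ω₂) = ∑_{k, l ≥ 0} (z + k ω₁ + l ω₂)^{-s}`,
continued in `s`. -/
def doubleZeta (ω₁ ω₂ : ℝ) (z : ℂ) : ℂ → ℂ :=
  analyticContinuation fun s => ∑' r : ℕ × ℕ, (z + r.1 * ω₁ + r.2 * ω₂) ^ (-s)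

/-- `χ(s; ω₁, ω₂) = ∑_{(k, l) ≠ (0, 0)} (k ω₁ + l ω₂)^{-s}`, continued in `s`. -/
def latticeZeta (ω₁ ω₂ : ℝ) : ℂ → ℂ :=
  analyticContinuation fun s =>
    ∑' r : ℕ × ℕ, if r = (0, 0) then (0 : ℂ) else ((r.1 * ω₁ + r.2 * ω₂ : ℝ) : ℂ) ^ (-s)

open Classical in
/-- The symmetric double gamma function
`Γ₂(z; ω₁, ω₂) = exp (∂ₛ ζ₂(s; z | ω₁, ω₂) - ∂ₛ χ(s; ω₁, ω₂))` at `s = 0`, with the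
normalization `z Γ₂(z; ω₁, ω₂) → 1` as `z → 0`, i.e. `Γ₂(ω₁; ω₁, ω₂) = √(2π / ω₂)`.
At its poles `-(k ω₁ + l ω₂)` it gets the value `0`, so that `Γ₂⁻¹` is right everywhere. -/
def Gamma2 (z : ℂ) (ω₁ ω₂ : ℝ) : ℂ :=
  if ∃ k l : ℕ, z = -(k * ω₁ + l * ω₂) then 0
  else Complex.exp (deriv (doubleZeta ω₁ ω₂ z) 0 - deriv (latticeZeta ω₁ ω₂) 0)

/-! ### Parameters. Indices are zero-based: `1 ≤ j ≤ n` becomes `j.val < n`. -/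

def parN (p q m n : ℕ) : ℤ := 2 * (m + n) - p - q

def parNu {p q : ℕ} (a : Fin p → ℂ) (b : Fin q → ℂ) : ℂ := ∑ j, a j - ∑ j, b j

def parMu {p q : ℕ} (m n : ℕ) (a : Fin p → ℂ) (b : Fin q → ℂ) : ℂ :=
  ∑ j with j.val < n, a j - ∑ j with n ≤ j.val, a j
    + ∑ j with j.val < m, b j - ∑ j with m ≤ j.val, b j

def parXi {p q : ℕ} (m n : ℕ) (a : Fin p → ℂ) (b : Fin q → ℂ) : ℂ :=
  ∑ j with j.val < n, a j ^ 2 - ∑ j with n ≤ j.val, a j ^ 2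
    + ∑ j with j.val < m, b j ^ 2 - ∑ j with m ≤ j.val, b j ^ 2

def LambdaPlus {p : ℕ} (n : ℕ) (a : Fin p → ℂ) (τ : ℝ) : Set ℂ :=
  {s | ∃ (j : Fin p) (l k : ℕ), n ≤ j.val ∧ s = a j + l * τ + k}

def LambdaMinus {q : ℕ} (m : ℕ) (b : Fin q → ℂ) (τ : ℝ) : Set ℂ :=
  {s | ∃ (j : Fin q) (l k : ℕ), m ≤ j.val ∧ 1 ≤ l ∧ 1 ≤ k ∧ s = b j - l * τ - k}

/-! ### The integrands. The argument `L` stands for `log z` on the Riemann surface of the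
logarithm (for `z > 0` it is the real number `ln z`), so that `z^{-s} = exp (-s L)`. -/

def calG {p q : ℕ} (m n : ℕ) (a : Fin p → ℂ) (b : Fin q → ℂ) (τ : ℝ) (s : ℂ) : ℂ :=
  ((∏ j with j.val < m, barnesG (b j - s) τ) *
      ∏ j with j.val < n, barnesG (1 + τ - a j + s) τ) /
    ((∏ j with m ≤ j.val, barnesG (1 + τ - b j + s) τ) *
      ∏ j with n ≤ j.val, barnesG (a j - s) τ)

/-- The integrand `𝒢(s) exp (π α s² / τ) z^{-s}` of the `K`-function. -/
def integrandK {p q : ℕ} (m n : ℕ) (a : Fin p → ℂ) (b : Fin q → ℂ) (τ : ℝ) (α L s : ℂ) : ℂ :=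
  calG m n a b τ s * Complex.exp (Real.pi * α / τ * s ^ 2) * Complex.exp (-s * L)

/-- The integrand of the `K̃`-function. -/
def integrandKtilde {p q : ℕ} (m n : ℕ) (a : Fin p → ℂ) (b : Fin q → ℂ) (ω₁ ω₂ : ℝ)
    (α L s : ℂ) : ℂ :=
  ((∏ j with j.val < m, Gamma2 (b j - s) ω₁ ω₂) *
      ∏ j with j.val < n, Gamma2 (ω₁ + ω₂ - a j + s) ω₁ ω₂) /
    ((∏ j with m ≤ j.val, Gamma2 (ω₁ + ω₂ - b j + s) ω₁ ω₂) *
      ∏ j with n ≤ j.val, Gamma2 (a j - s) ω₁ ω₂) *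
    Complex.exp (Real.pi * α / (ω₁ * ω₂) * s ^ 2) * Complex.exp (-s * L)

/-! ### The seven cases of parameters -/

/-- (i) Log-quadratic case. -/
def LogQuadraticCase (p q m n : ℕ) : Prop := 0 < parN p q m n

/-- (ii) Quadratic case. -/
def QuadraticCase (p q m n : ℕ) (α : ℂ) : Prop :=
  parN p q m n = 0 ∧ 0 ≤ α.re ∧
    4 * α ≠ (p - q) * Complex.I ∧ 4 * α ≠ -((p - q) * Complex.I)

/-- (iii) Upper-balanced case (`arg μ` is meaningful only for `μ ≠ 0`). -/
def UpperBalancedCase {p q : ℕ} (m n : ℕ) (a : Fin p → ℂ) (b : Fin q → ℂ) (α : ℂ) : Prop :=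
  parN p q m n = 0 ∧ 4 * α = (q - p) * Complex.I ∧ p ≠ q ∧
    parMu m n a b ≠ 0 ∧ (parMu m n a b).arg ≠ Real.pi / 2

/-- (iv) Lower-balanced case. -/
def LowerBalancedCase {p q : ℕ} (m n : ℕ) (a : Fin p → ℂ) (b : Fin q → ℂ) (α : ℂ) : Prop :=
  parN p q m n = 0 ∧ 4 * α = (p - q) * Complex.I ∧ p ≠ q ∧
    parMu m n a b ≠ 0 ∧ (parMu m n a b).arg ≠ -(Real.pi / 2)

/-- (v) Balanced case. -/
def BalancedCase {p q : ℕ} (m n : ℕ) (a : Fin p → ℂ) (b : Fin q → ℂ) (α : ℂ) : Prop :=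
  parN p q m n = 0 ∧ α = 0 ∧ p = q ∧ (parMu m n a b).re ≠ 0

/-- (vi) Linear case. -/
def LinearCase {p q : ℕ} (m n : ℕ) (a : Fin p → ℂ) (b : Fin q → ℂ) (α : ℂ) : Prop :=
  parN p q m n = 0 ∧ α = 0 ∧ p = q ∧ parMu m n a b = 0 ∧ (parNu a b).re < 0

/-- (vii) Logarithmic case. -/
def LogarithmicCase {p q : ℕ} (m n : ℕ) (a : Fin p → ℂ) (b : Fin q → ℂ) (α : ℂ) : Prop :=
  parN p q m n = 0 ∧ α = 0 ∧ p = q ∧ parMu m n a b = 0 ∧ parNu a b = 0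

/-- The parameters are admissible, and `z` with `log z = L` lies in the domain of the
`K`-function: the whole Riemann surface of the logarithm in cases (i)-(v), the sector
`|arg z| < -π Re ν / (2 τ)` in case (vi), and `(0, 1) ∪ (1, ∞)` in case (vii). -/
def KAdmissible {p q : ℕ} (m n : ℕ) (a : Fin p → ℂ) (b : Fin q → ℂ) (τ : ℝ) (α L : ℂ) : Prop :=
  LambdaPlus n a τ ∩ LambdaMinus m b τ = ∅ ∧
  (LogQuadraticCase p q m n ∨ QuadraticCase p q m n α ∨ UpperBalancedCase m n a b α ∨
    LowerBalancedCase m n a b α ∨ BalancedCase m n a b α ∨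
    (LinearCase m n a b α ∧ |L.im| < -(Real.pi * (parNu a b).re / (2 * τ))) ∨
    (LogarithmicCase m n a b α ∧ L.im = 0 ∧ L.re ≠ 0))

/-! ### Contours -/

/-- The direction `e^{iθ}` of a ray. -/
def dir (θ : ℝ) : ℂ := Complex.exp (θ * Complex.I)

/-- The allowed slopes `θ⁻`, `θ⁺` of the two ends of the contour. -/
def AllowedAngles {p q : ℕ} (m n : ℕ) (a : Fin p → ℂ) (b : Fin q → ℂ) (α L : ℂ)
    (θm θp : ℝ) : Prop :=
  (LogQuadraticCase p q m n ∧
    θp ∈ Set.Ioo (Real.pi / 4) (3 * Real.pi / 4) ∧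
    θm ∈ Set.Ioo (-(3 * Real.pi / 4)) (-(Real.pi / 4))) ∨
  (QuadraticCase p q m n α ∧
    ((α + (p - q) * Complex.I / 4) * dir θp ^ 2).re < 0 ∧
    ((α - (p - q) * Complex.I / 4) * dir θm ^ 2).re < 0) ∨
  (UpperBalancedCase m n a b α ∧
    0 < (parMu m n a b * dir θp).re ∧ (Complex.I * (q - p) * dir θm ^ 2).re < 0) ∨
  (LowerBalancedCase m n a b α ∧
    (Complex.I * (p - q) * dir θp ^ 2).re < 0 ∧ 0 < (parMu m n a b * dir θm).re) ∨
  (BalancedCase m n a b α ∧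
    0 < (parMu m n a b * dir θp).re ∧ 0 < (parMu m n a b * dir θm).re) ∨
  (LinearCase m n a b α ∧ θp = Real.pi / 2 ∧ θm = -(Real.pi / 2)) ∨
  (LogarithmicCase m n a b α ∧ ∃ ε ∈ Set.Ioo 0 (Real.pi / 2),
    (0 < L.re ∧ θp = ε ∧ θm = -ε) ∨
    (L.re < 0 ∧ θp = Real.pi - ε ∧ θm = -(Real.pi - ε)))

/-- `γ` is a simple piecewise smooth curve `ℒ_{θ⁻, θ⁺}`: it comes in along a ray of direction
`e^{iθ⁻}` in the lower half-plane, and goes out along a ray of direction `e^{iθ⁺}` in the upper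
half-plane. -/
structure IsContour (θm θp : ℝ) (γ : ℝ → ℂ) : Prop where
  lower_angle : θm ∈ Set.Ioo (-Real.pi) 0
  upper_angle : θp ∈ Set.Ioo 0 Real.pi
  lipschitz : ∃ C : NNReal, LipschitzWith C γ
  piecewise_smooth : ∃ S : Finset ℝ, ∀ t ∉ S, ContDiffAt ℝ 1 γ t
  simple : Function.Injective γ
  upper_ray : ∃ (c : ℂ) (T : ℝ), ∀ t : ℝ, T ≤ t → γ t = c + t * dir θp
  lower_ray : ∃ (c : ℂ) (T : ℝ), ∀ t : ℝ, t ≤ T → γ t = c - t * dir θm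

/-- `γ` divides the plane into two domains, one of which contains `P` and all large positive
numbers, while the other one contains `M`. -/
def Separates (γ : ℝ → ℂ) (M P : Set ℂ) : Prop :=
  ∃ U V : Set ℂ, IsOpen U ∧ IsOpen V ∧ IsConnected U ∧ IsConnected V ∧ Disjoint U V ∧
    U ∪ V = (Set.range γ)ᶜ ∧ (∀ᶠ x : ℝ in atTop, (x : ℂ) ∈ V) ∧ M ⊆ U ∧ P ⊆ V

/-- `γ` is a contour that may be used in the definition of the `K`-function at `log z = L`. -/
def IsKContour {p q : ℕ} (m n : ℕ) (a : Fin p → ℂ) (b : Fin q → ℂ) (τ : ℝ) (α L : ℂ)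
    (γ : ℝ → ℂ) : Prop :=
  (∃ θm θp : ℝ, AllowedAngles m n a b α L θm θp ∧ IsContour θm θp γ) ∧
    Separates γ (LambdaMinus m b τ) (LambdaPlus n a τ)

/-- Absolute convergence of `∫_γ f(s) ds`. -/
def ContourIntegrable (f : ℂ → ℂ) (γ : ℝ → ℂ) : Prop :=
  Integrable fun t : ℝ => f (γ t) * deriv γ t

/-- `(1 / (2πi)) ∫_γ f(s) ds`. -/
def contourMean (f : ℂ → ℂ) (γ : ℝ → ℂ) : ℂ :=
  (2 * Real.pi * Complex.I)⁻¹ * ∫ t : ℝ, f (γ t) * deriv γ t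

/-- `w` is the common value of the convergent integrals `(1 / (2πi)) ∫_γ f(s) ds` over all
curves `γ` of the nonempty family `𝒞`. -/
def IsCommonValue (f : ℂ → ℂ) (𝒞 : Set (ℝ → ℂ)) (w : ℂ) : Prop :=
  𝒞.Nonempty ∧ ∀ γ ∈ 𝒞, ContourIntegrable f γ ∧ contourMean f γ = w

open Classical in
/-- The integral `(1 / (2πi)) ∫_γ f(s) ds` over any of the curves `γ` of the family `𝒞`. -/
def commonValue (f : ℂ → ℂ) (𝒞 : Set (ℝ → ℂ)) : ℂ :=
  if h : ∃ w, IsCommonValue f 𝒞 w then Classical.choose h else 0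

/-! ### The functions `K` and `K̃` -/

/-- The Meijer-Barnes `K`-function `K_{p,q}^{m,n}(a; b | z; τ, α)` at `log z = L`. -/
def meijerBarnesK {p q : ℕ} (m n : ℕ) (a : Fin p → ℂ) (b : Fin q → ℂ) (τ : ℝ) (α L : ℂ) : ℂ :=
  commonValue (integrandK m n a b τ α L) {γ | IsKContour m n a b τ α L γ}

/-- Reversal and rescaling of a parameter vector: `c̃_j = c_{r-j+1} / ω`. -/
def revScale {r : ℕ} (ω : ℝ) (c : Fin r → ℂ) : Fin r → ℂ := fun j => c j.rev / ω

/-- `η = α - N ln(ω₂) / (2π)`. -/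
def etaParam (p q m n : ℕ) (ω₂ : ℝ) (α : ℂ) : ℂ :=
  α - parN p q m n * Real.log ω₂ / (2 * Real.pi)

/-- The constant `C₁`. -/
def constC1 {p q : ℕ} (m n : ℕ) (a : Fin p → ℂ) (b : Fin q → ℂ) (ω₁ ω₂ : ℝ) : ℂ :=
  ((2 * Real.pi : ℝ) : ℂ) ^
      (((ω₁ + ω₂) * (m + n - q) - parNu a b) / (2 * ω₁) : ℂ) *
    (ω₂ : ℂ) ^
      (-parN p q m n - parXi m n a b / (2 * ω₁ * ω₂)
        + parMu m n a b * (ω₁ + ω₂) / (2 * ω₁ * ω₂) : ℂ) *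
    ω₁

/-- The constant `C₂`. -/
def constC2 {p q : ℕ} (m n : ℕ) (a : Fin p → ℂ) (b : Fin q → ℂ) (ω₁ ω₂ : ℝ) : ℂ :=
  ((2 * Real.pi : ℝ) : ℂ) ^ ((q - p) / 2 : ℂ) *
    (ω₂ : ℂ) ^ ((parN p q m n * (ω₁ + ω₂) / 2 - parMu m n a b) / ω₂ : ℂ)

/-- The logarithm of `C₂` that goes with the real logarithms of the bases `2π` and `ω₂`. -/
def logC2 {p q : ℕ} (m n : ℕ) (a : Fin p → ℂ) (b : Fin q → ℂ) (ω₁ ω₂ : ℝ) : ℂ :=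
  Real.log (2 * Real.pi) * ((q - p) / 2) +
    Real.log ω₂ * ((parN p q m n * (ω₁ + ω₂) / 2 - parMu m n a b) / ω₂)

theorem exp_logC2 {p q : ℕ} (m n : ℕ) (a : Fin p → ℂ) (b : Fin q → ℂ) (ω₁ ω₂ : ℝ)
    (h₂ : 0 < ω₂) : Complex.exp (logC2 m n a b ω₁ ω₂) = constC2 m n a b ω₁ ω₂ := by
  have h1 : ((2 * Real.pi : ℝ) : ℂ) ≠ 0 := by exact_mod_cast Real.two_pi_pos.ne'
  have h2 : (ω₂ : ℂ) ≠ 0 := by exact_mod_cast h₂.ne'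
  rw [logC2, constC2, Complex.exp_add, Complex.cpow_def_of_ne_zero h1,
    Complex.cpow_def_of_ne_zero h2, Complex.ofReal_log Real.two_pi_pos.le,
    Complex.ofReal_log h₂.le]

/-- The logarithm of the argument `C₂ z^{ω₁}`, where `log z = L`. -/
def logArg {p q : ℕ} (m n : ℕ) (a : Fin p → ℂ) (b : Fin q → ℂ) (ω₁ ω₂ : ℝ) (L : ℂ) : ℂ :=
  logC2 m n a b ω₁ ω₂ + ω₁ * L

/-- `γ` is a contour for the `K`-function
`K_{q,p}^{p-n,q-m}(ã; b̃ | C₂ z^{ω₁}; ω₂/ω₁, η)`, where `log z = L`. -/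
def IsSwappedContour {p q : ℕ} (m n : ℕ) (a : Fin p → ℂ) (b : Fin q → ℂ) (ω₁ ω₂ : ℝ) (α L : ℂ)
    (γ : ℝ → ℂ) : Prop :=
  IsKContour (p - n) (q - m) (revScale ω₁ b) (revScale ω₁ a) (ω₂ / ω₁)
    (etaParam p q m n ω₂ α) (logArg m n a b ω₁ ω₂ L) γ

/-- The function `K̃_{p,q}^{m,n}(a; b | z; ω₁, ω₂, α)` at `log z = L`: the contours are the
curves `ω₁ γ`, with `γ` as in `IsSwappedContour`. -/
def meijerBarnesKtilde {p q : ℕ} (m n : ℕ) (a : Fin p → ℂ) (b : Fin q → ℂ) (ω₁ ω₂ : ℝ)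
    (α L : ℂ) : ℂ :=
  commonValue (integrandKtilde m n a b ω₁ ω₂ α L)
    {δ | ∃ γ : ℝ → ℂ, IsSwappedContour m n a b ω₁ ω₂ α L γ ∧ δ = fun t => ω₁ * γ t}

end

/-!
The theorem reduces to one relation between the two double gamma functions, valid for every complex
`z` (`Gamma2_eq`):
`Γ₂(ω₁ z; ω₁, ω₂) = (2π)^{z/2} ω₂^{-Q(z)} / G(z; τ)`, where `τ = ω₂ / ω₁` and
`Q(z) = 1 - z (1 + τ) / (2τ) + z² / (2τ)`. At the poles of `Γ₂` both sides are `0` by convention.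
Since `Q(1 + τ - z) = Q(z)`, the substitution `s ↦ ω₁ s` turns the integrand of `K̃` into that of `K`
with the roles of numerator and denominator exchanged; the exponents of `2π` and `ω₂` add up to a
quadratic polynomial in `s`, whose coefficients are absorbed in `C₁`, `C₂` and `η`
(`integrandKtilde_scale`). The integrands agree pointwise, so that absolute convergence, contour
integrals and common values correspond without any asymptotic analysis (`contour_scale`,
`commonValue_scale`).

For the relation between `Γ₂` and `G`, let `Ω` run through the points `k τ + l`, and let
`χ(s) = ∑_{Ω ≠ 0} Ω^{-s}`. A Taylor expansion in `z` gives
`∑ (z + Ω)^{-s} = χ(s) + z^{-s} - s z χ(s + 1) + s (s + 1) / 2 * z² χ(s + 2) + E(s)`, where `E` is a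
lattice sum that converges for `Re s > -1` (`tsum_add_latPt_cpow`). The derivative of `E` at `0` is
the negative logarithm of the canonical product in `G` (`hasSum_deriv_taylorSum_zero`), so that the
logarithm of `Γ₂` is determined by `E'(0)` and by the Laurent coefficients of `χ` at `1` and `2`.
The continuation of `χ`, again for `Re s > -1`, comes from the Euler-Maclaurin formula in `l`: the
main terms sum over `k` to values of the Riemann zeta function, and the remainders form an absolutely
convergent lattice sum (`tsum_latTerm`).

The Laurent coefficients contain the sums of the Euler-Maclaurin remainders at `s = 1` and `s = 2`.
The row sums of these remainders are the errors of the asymptotic expansions of `ψ` and `ψ'`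
(`tsum_emRem_one`, `tsum_emRem_two`). With Stirling's formula this shows that the limits which define
`C(τ)` and `D(τ)` exist and identifies them with the Laurent coefficients (`gammaModularC_eq`,
`gammaModularD_eq`), hence `a(τ)` and `b(τ)` with the coefficients in the product for `Γ₂`.
-/

noncomputable section

/-! ### Remainders of Taylor and Euler-Maclaurin expansions of powers -/

theorem cpow_neg_two_eq (x : ℂ) : x ^ (-2 : ℂ) = 1 / x ^ 2 := by
  rw [show (-2 : ℂ) = ((-2 : ℤ) : ℂ) by norm_num, Complex.cpow_intCast]
  simp [zpow_neg]

theorem cpow_neg_three_eq (x : ℂ) : x ^ (-3 : ℂ) = 1 / x ^ 3 := by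
  rw [show (-3 : ℂ) = ((-3 : ℤ) : ℂ) by norm_num, Complex.cpow_intCast]
  simp [zpow_neg]

theorem hasDerivAt_cpow_line (Ω z c : ℂ) (t : ℝ) (h : Ω + t * z ∈ Complex.slitPlane) :
    HasDerivAt (fun t : ℝ => (Ω + t * z) ^ c) (c * (Ω + t * z) ^ (c - 1) * z) t := by
  have h1 : HasDerivAt (fun w : ℂ => Ω + w * z) z (t : ℂ) := by
    simpa using ((hasDerivAt_id (t : ℂ)).mul_const z).const_add Ω
  exact (h1.cpow_const h).comp_ofReal

/-- The remainder of the Taylor expansion of order two of `z ↦ (z + Ω)^{-s}` at `0`. -/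
def taylorRem (z s Ω : ℂ) : ℂ :=
  (z + Ω) ^ (-s) - Ω ^ (-s) + s * z * Ω ^ (-s - 1) - s * (s + 1) / 2 * z ^ 2 * Ω ^ (-s - 2)

theorem norm_cpow_le_of_le {w c : ℂ} {d : ℝ} (hd : 0 < d) (hw : d ≤ ‖w‖) (hc : c.re ≤ 0) :
    ‖w ^ c‖ ≤ d ^ c.re * Real.exp (Real.pi * |c.im|) := by
  refine (Complex.norm_cpow_le w c).trans ?_
  rw [div_eq_mul_inv, ← Real.exp_neg]
  gcongr ?_ * Real.exp ?_
  · exact Real.rpow_le_rpow_of_nonpos hd hw hc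
  · have := Complex.abs_arg_le_pi w
    calc -(w.arg * c.im) ≤ |w.arg * c.im| := neg_le_abs _
      _ = |w.arg| * |c.im| := abs_mul _ _
      _ ≤ _ := by gcongr

/-- Bound by the third derivative along the segment from `Ω` to `Ω + z`. -/
theorem norm_taylorRem_le {z s : ℂ} {Ω : ℝ} (hΩ : 0 < Ω) (hz : 2 * ‖z‖ ≤ Ω) (hs : -3 ≤ s.re) :
    ‖taylorRem z s Ω‖ ≤ ‖s * (s + 1) * (s + 2)‖ * ‖z‖ ^ 3 *
      ((Ω / 2) ^ (-s.re - 3) * Real.exp (Real.pi * |s.im|)) := by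
  have hre : ∀ t ∈ Set.Icc (0:ℝ) 1, Ω / 2 ≤ ((Ω : ℂ) + t * z).re := by
    intro t ht
    have h1 := Complex.abs_re_le_norm z
    have h2 : -‖z‖ ≤ t * z.re := by
      have := abs_le.1 h1
      nlinarith [ht.1, ht.2, norm_nonneg z]
    simp
    linarith
  have hslit : ∀ t ∈ Set.Icc (0:ℝ) 1, (Ω : ℂ) + t * z ∈ Complex.slitPlane := fun t ht =>
    Or.inl ((half_pos hΩ).trans_le (hre t ht))
  -- The Taylor polynomial of order two at `Ω + t z`, evaluated at `Ω + z`; its derivative in `t`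
  -- contains the third derivative of the power only.
  have key := norm_image_sub_le_of_norm_deriv_le_segment_01'
    (f := fun t : ℝ => ((Ω : ℂ) + t * z) ^ (-s) - s * z * (1 - t) * ((Ω : ℂ) + t * z) ^ (-s - 1)
      + s * (s + 1) / 2 * z ^ 2 * (1 - t) ^ 2 * ((Ω : ℂ) + t * z) ^ (-s - 2))
    (f' := fun t : ℝ => -(s * (s + 1) * (s + 2)) / 2 * z ^ 3 * (1 - t) ^ 2 *
      ((Ω : ℂ) + t * z) ^ (-s - 3))
    (C := ‖s * (s + 1) * (s + 2)‖ * ‖z‖ ^ 3 *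
      ((Ω / 2) ^ (-s.re - 3) * Real.exp (Real.pi * |s.im|))) ?_ ?_
  · refine le_trans (le_of_eq ?_) key
    simp only [taylorRem]
    congr 1
    norm_num
    rw [add_comm z]
    ring
  · intro t ht
    refine HasDerivAt.hasDerivWithinAt ?_
    have d0 := hasDerivAt_cpow_line Ω z (-s) t (hslit t ht)
    have d1 := hasDerivAt_cpow_line Ω z (-s - 1) t (hslit t ht)
    have d2 := hasDerivAt_cpow_line Ω z (-s - 2) t (hslit t ht)
    have e : HasDerivAt (fun t : ℝ => (1 - t : ℂ)) (-1) t := by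
      simpa using ((hasDerivAt_id (t : ℂ)).const_sub 1).comp_ofReal
    have := (d0.sub ((e.const_mul (s * z)).mul d1)).add
      (((e.pow 2).const_mul (s * (s + 1) / 2 * z ^ 2)).mul d2)
    refine this.congr_deriv ?_
    rw [show -s - 1 - 1 = -s - 2 by ring, show -s - 2 - 1 = -s - 3 by ring]
    simp
    ring
  · intro t ht
    have ht' : t ∈ Set.Icc (0:ℝ) 1 := ⟨ht.1, ht.2.le⟩
    have h1 := norm_cpow_le_of_le (c := -s - 3) (half_pos hΩ)
      ((hre t ht').trans (Complex.re_le_norm _)) (by simp; linarith)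
    have h2 : ‖(1 - t : ℂ)‖ ≤ 1 := by
      rw [← Complex.ofReal_one, ← Complex.ofReal_sub, Complex.norm_real, Real.norm_eq_abs, abs_le]
      constructor <;> linarith [ht.1, ht.2]
    simp only [norm_mul, norm_neg, norm_div, norm_pow] at h1 ⊢
    simp only [Complex.sub_re, Complex.neg_re, Complex.sub_im, Complex.neg_im] at h1
    norm_num at h1 ⊢
    have h3 : ‖(1 - t : ℂ)‖ ^ 2 ≤ 1 := pow_le_one₀ (norm_nonneg _) h2
    calc ‖s‖ * ‖s + 1‖ * ‖s + 2‖ / 2 * ‖z‖ ^ 3 * ‖(1 - t : ℂ)‖ ^ 2 * ‖((Ω : ℂ) + t * z) ^ (-s - 3)‖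
        ≤ ‖s‖ * ‖s + 1‖ * ‖s + 2‖ / 1 * ‖z‖ ^ 3 * 1 *
          ((Ω / 2) ^ (-s.re - 3) * Real.exp (Real.pi * |s.im|)) := by gcongr; norm_num
      _ = _ := by ring

/-- The remainder of the Euler-Maclaurin formula for `y ↦ y^{-s}` on `[y, y + 1]`, namely
`y^{-s} - (F(y) - F(y + 1))` with `F(y) = y^{1-s}/(s-1) + y^{-s}/2 + s y^{-s-1}/12`. The divided
difference makes it an entire function of `s`. -/
def emRem (s : ℂ) (y : ℝ) : ℂ :=
  (y : ℂ) ^ (-s) - dslope (fun u : ℂ => (y : ℂ) ^ (1 - u) - ((y + 1 : ℝ) : ℂ) ^ (1 - u)) 1 s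
    - ((y : ℂ) ^ (-s) - ((y + 1 : ℝ) : ℂ) ^ (-s)) / 2
    - s / 12 * ((y : ℂ) ^ (-s - 1) - ((y + 1 : ℝ) : ℂ) ^ (-s - 1))

theorem emRem_of_ne {s : ℂ} (hs : s ≠ 1) (y : ℝ) :
    emRem s y = (y : ℂ) ^ (-s) - ((y : ℂ) ^ (1 - s) - ((y + 1 : ℝ) : ℂ) ^ (1 - s)) / (s - 1)
    - ((y : ℂ) ^ (-s) - ((y + 1 : ℝ) : ℂ) ^ (-s)) / 2
    - s / 12 * ((y : ℂ) ^ (-s - 1) - ((y + 1 : ℝ) : ℂ) ^ (-s - 1)) := by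
  rw [emRem, dslope_of_ne _ hs, slope_def_field]
  simp

theorem hasDerivAt_const_cpow_one_sub {y : ℝ} (hy : 0 < y) (s : ℂ) :
    HasDerivAt (fun u : ℂ => (y : ℂ) ^ (1 - u)) (-(y ^ (1 - s) * Real.log y)) s := by
  have h := ((hasDerivAt_id s).const_sub 1).const_cpow (c := (y : ℂ))
    (Or.inl (by exact_mod_cast hy.ne'))
  rw [Complex.ofReal_log hy.le]
  refine h.congr_deriv ?_
  simp

theorem deriv_cpow_one_sub_sub {y : ℝ} (hy : 0 < y) :
    deriv (fun u : ℂ => (y : ℂ) ^ (1 - u) - ((y + 1 : ℝ) : ℂ) ^ (1 - u)) 1 =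
      Real.log (y + 1) - Real.log y := by
  have h := (hasDerivAt_const_cpow_one_sub hy 1).sub
    (hasDerivAt_const_cpow_one_sub (y := y + 1) (by linarith) 1)
  refine h.deriv.trans ?_
  simp only [sub_self, Complex.cpow_zero]
  ring

theorem emRem_one {y : ℝ} (hy : 0 < y) :
    emRem 1 y = ((1 / y - (Real.log (y + 1) - Real.log y) - (1 / y - 1 / (y + 1)) / 2
      - 1 / 12 * (1 / y ^ 2 - 1 / (y + 1) ^ 2) : ℝ) : ℂ) := by
  have e : (-1 - 1 : ℂ) = -2 := by norm_num
  rw [emRem, dslope_same, deriv_cpow_one_sub_sub hy, e,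
    cpow_neg_two_eq, cpow_neg_two_eq]
  simp only [Complex.cpow_neg_one]
  push_cast
  ring

theorem emRem_two (y : ℝ) :
    emRem 2 y = ((1 / y ^ 2 - (1 / y - 1 / (y + 1)) - (1 / y ^ 2 - 1 / (y + 1) ^ 2) / 2
      - 1 / 6 * (1 / y ^ 3 - 1 / (y + 1) ^ 3) : ℝ) : ℂ) := by
  have e : (-2 - 1 : ℂ) = -3 := by norm_num
  have e' : (1 - 2 : ℂ) = -1 := by norm_num
  rw [emRem_of_ne (by norm_num), e, e', cpow_neg_two_eq, cpow_neg_two_eq, cpow_neg_three_eq,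
    cpow_neg_three_eq, Complex.cpow_neg_one, Complex.cpow_neg_one]
  push_cast
  ring

theorem differentiable_emRem {y : ℝ} (hy : 0 < y) : Differentiable ℂ fun s => emRem s y := by
  have h0 : (y : ℂ) ≠ 0 := by exact_mod_cast hy.ne'
  have h1 : ((y + 1 : ℝ) : ℂ) ≠ 0 := by exact_mod_cast (by linarith : y + 1 ≠ 0)
  have hd : Differentiable ℂ
      (dslope (fun u : ℂ => (y : ℂ) ^ (1 - u) - ((y + 1 : ℝ) : ℂ) ^ (1 - u)) 1) := by
    rw [← differentiableOn_univ, Complex.differentiableOn_dslope univ_mem]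
    refine Differentiable.differentiableOn fun s => ?_
    exact ((hasDerivAt_const_cpow_one_sub hy s).sub
      (hasDerivAt_const_cpow_one_sub (y := y + 1) (by linarith) s)).differentiableAt
  have hp : ∀ w : ℂ, w ≠ 0 → Differentiable ℂ fun s : ℂ => w ^ (-s) := fun w hw =>
    differentiable_id.neg.const_cpow (Or.inl hw)
  have hp' : ∀ w : ℂ, w ≠ 0 → Differentiable ℂ fun s : ℂ => w ^ (-s - 1) := fun w hw =>
    (differentiable_id.neg.sub_const 1).const_cpow (Or.inl hw)
  exact (((hp _ h0).sub hd).sub (((hp _ h0).sub (hp _ h1)).div_const 2)).sub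
    ((differentiable_id.div_const 12).mul ((hp' _ h0).sub (hp' _ h1)))

/-- The bound comes from the integral of the third derivative against the periodic Bernoulli
polynomial `B₃`, in the form of a mean value inequality for a primitive of the integrand. -/
theorem norm_emRem_le {s : ℂ} {y : ℝ} (hy : 0 < y) (hs : -3 ≤ s.re) :
    ‖emRem s y‖ ≤ ‖s * (s + 1) * (s + 2)‖ * y ^ (-s.re - 3) := by
  have hpos : ∀ t ∈ Set.Icc (0:ℝ) 1, 0 < y + t := fun t ht => by linarith [ht.1]
  have hslit : ∀ t ∈ Set.Icc (0:ℝ) 1, (y : ℂ) + t * 1 ∈ Complex.slitPlane := fun t ht => by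
    rw [mul_one, ← Complex.ofReal_add]
    exact Complex.ofReal_mem_slitPlane.2 (hpos t ht)
  -- A primitive of the power, which is a logarithm for `s = 1`.
  obtain ⟨G, hG, hGd⟩ : ∃ G : ℝ → ℂ,
      (∀ t ∈ Set.Icc (0:ℝ) 1, HasDerivAt G (((y : ℂ) + t * 1) ^ (-s)) t) ∧ G 1 - G 0 =
      dslope (fun u : ℂ => (y : ℂ) ^ (1 - u) - ((y + 1 : ℝ) : ℂ) ^ (1 - u)) 1 s := by
    by_cases h1 : s = 1
    · refine ⟨fun t => (Real.log (y + t) : ℂ), fun t ht => ?_, ?_⟩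
      · have := (((hasDerivAt_id t).const_add y).log (hpos t ht).ne').ofReal_comp
        refine this.congr_deriv ?_
        rw [h1, Complex.cpow_neg_one]
        simp
      · rw [h1, dslope_same, deriv_cpow_one_sub_sub hy]
        simp
    · have h1' : (1 - s) ≠ 0 := sub_ne_zero.2 (Ne.symm h1)
      refine ⟨fun t => ((y : ℂ) + t * 1) ^ (1 - s) / (1 - s), fun t ht => ?_, ?_⟩
      · refine ((hasDerivAt_cpow_line y 1 (1 - s) t (hslit t ht)).div_const (1 - s)).congr_deriv ?_
        rw [show 1 - s - 1 = -s by ring]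
        field_simp
      · rw [dslope_of_ne _ h1, slope_def_field]
        have h2 : s - 1 ≠ 0 := sub_ne_zero.2 h1
        simp
        field_simp
        ring
  have key := norm_image_sub_le_of_norm_deriv_le_segment_01'
    (f := fun t : ℝ => G t - (t - 1 / 2 : ℂ) * ((y : ℂ) + t * 1) ^ (-s)
      - (t ^ 2 - t + 1 / 6 : ℂ) / 2 * s * ((y : ℂ) + t * 1) ^ (-s - 1)
      - (t ^ 3 - 3 / 2 * t ^ 2 + t / 2 : ℂ) / 6 * (s * (s + 1)) * ((y : ℂ) + t * 1) ^ (-s - 2))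
    (f' := fun t : ℝ => (s * (s + 1) * (s + 2)) * ((t ^ 3 - 3 / 2 * t ^ 2 + t / 2 : ℝ) / 6) *
      ((y : ℂ) + t * 1) ^ (-s - 3))
    (C := ‖s * (s + 1) * (s + 2)‖ * y ^ (-s.re - 3)) ?_ ?_
  · refine le_trans (le_of_eq ?_) key
    rw [← norm_neg]
    congr 1
    rw [emRem, ← hGd]
    norm_num
    ring
  · intro t ht
    refine HasDerivAt.hasDerivWithinAt ?_
    have d0 := hasDerivAt_cpow_line y 1 (-s) t (hslit t ht)
    have d1 := hasDerivAt_cpow_line y 1 (-s - 1) t (hslit t ht)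
    have d2 := hasDerivAt_cpow_line y 1 (-s - 2) t (hslit t ht)
    have e : HasDerivAt (fun t : ℝ => (t : ℂ)) 1 t := (hasDerivAt_id (t : ℂ)).comp_ofReal
    have e1 := e.sub_const (1 / 2 : ℂ)
    have e2 := (((e.pow 2).sub e).add_const (1 / 6 : ℂ)).div_const 2
    have e3 := (((e.pow 3).sub ((e.pow 2).const_mul (3 / 2 : ℂ))).add (e.div_const 2)).div_const 6
    have := (((hG t ht).sub (e1.mul d0)).sub ((e2.mul_const s).mul d1)).sub
      ((e3.mul_const (s * (s + 1))).mul d2)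
    refine this.congr_deriv ?_
    rw [show -s - 1 - 1 = -s - 2 by ring, show -s - 2 - 1 = -s - 3 by ring]
    simp
    ring
  · intro t ht
    have ht' : t ∈ Set.Icc (0:ℝ) 1 := ⟨ht.1, ht.2.le⟩
    have h2 : ‖((t ^ 3 - 3 / 2 * t ^ 2 + t / 2 : ℝ) : ℂ) / 6‖ ≤ 1 := by
      rw [norm_div, Complex.norm_real, Real.norm_eq_abs]
      have : |t ^ 3 - 3 / 2 * t ^ 2 + t / 2| ≤ 1 := by
        have h3 : t ^ 2 ≤ 1 := pow_le_one₀ ht.1 ht.2.le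
        have h4 : t ^ 3 ≤ 1 := pow_le_one₀ ht.1 ht.2.le
        have h5 : t ^ 3 ≤ t ^ 2 := by nlinarith [ht.1, ht.2, sq_nonneg t]
        have h6 : 0 ≤ t ^ 3 := pow_nonneg ht.1 3
        rw [abs_le]
        constructor <;> nlinarith [ht.1, ht.2]
      norm_num
      linarith
    have h1 : ‖((y : ℂ) + t * 1) ^ (-s - 3)‖ ≤ y ^ (-s.re - 3) := by
      rw [mul_one, ← Complex.ofReal_add, Complex.norm_cpow_eq_rpow_re_of_pos (hpos t ht')]
      simp only [Complex.sub_re, Complex.neg_re, Complex.re_ofNat]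
      exact Real.rpow_le_rpow_of_nonpos hy (by linarith [ht.1]) (by linarith)
    rw [norm_mul, norm_mul _ (_ / _)]
    gcongr
    exact mul_le_of_le_one_right (norm_nonneg _) h2

/-! ### Locally dominated series of holomorphic functions -/

/-- Locally uniform domination of the terms of a series `∑ F i` on `U` by summable constants, up to
finitely many terms on each compact set. -/
def LocallyDominatedOn {ι : Type*} (F : ι → ℂ → ℂ) (U : Set ℂ) : Prop :=
  ∀ K ⊆ U, IsCompact K →
    ∃ v : ι → ℝ, Summable v ∧ ∀ᶠ i in cofinite, ∀ s ∈ K, ‖F i s‖ ≤ v i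

namespace LocallyDominatedOn

variable {ι : Type*} {F : ι → ℂ → ℂ} {U : Set ℂ}

theorem tendstoLocallyUniformlyOn (h : LocallyDominatedOn F U) (hU : IsOpen U) :
    TendstoLocallyUniformlyOn (fun (t : Finset ι) s => ∑ i ∈ t, F i s) (fun s => ∑' i, F i s)
      atTop U := by
  rw [tendstoLocallyUniformlyOn_iff_forall_isCompact hU]
  intro K hK hK'
  obtain ⟨v, hv, hb⟩ := h K hK hK'
  exact tendstoUniformlyOn_tsum_of_cofinite_eventually hv hb

theorem summable (h : LocallyDominatedOn F U) {s : ℂ} (hs : s ∈ U) : Summable fun i => F i s := by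
  obtain ⟨v, hv, hb⟩ := h {s} (by simpa using hs) isCompact_singleton
  exact Summable.of_norm_bounded_eventually hv (hb.mono fun i hi => hi s rfl)

theorem differentiableOn (h : LocallyDominatedOn F U) (hU : IsOpen U)
    (hF : ∀ i, DifferentiableOn ℂ (F i) U) : DifferentiableOn ℂ (fun s => ∑' i, F i s) U :=
  (h.tendstoLocallyUniformlyOn hU).differentiableOn
    (Eventually.of_forall fun t => by
      simpa only [Finset.sum_fn] using DifferentiableOn.fun_sum fun i _ => hF i) hU

theorem hasSum_deriv (h : LocallyDominatedOn F U) (hU : IsOpen U)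
    (hF : ∀ i, DifferentiableOn ℂ (F i) U) {s : ℂ} (hs : s ∈ U) :
    HasSum (fun i => deriv (F i) s) (deriv (fun s => ∑' i, F i s) s) := by
  have hd := ((h.tendstoLocallyUniformlyOn hU).deriv (Eventually.of_forall fun t => by
      simpa only [Finset.sum_fn] using DifferentiableOn.fun_sum fun i _ => hF i) hU).tendsto_at hs
  refine hd.congr fun t => ?_
  exact deriv_fun_sum fun i _ => (hF i).differentiableAt (hU.mem_nhds hs)

end LocallyDominatedOn

/-- The half-plane `Re s > -1`. -/
def halfPlane : Set ℂ := {s | -1 < s.re}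

theorem isOpen_halfPlane : IsOpen halfPlane := isOpen_lt continuous_const Complex.continuous_re

/-- A remainder of third order, `O(y^{-Re s - 3})` with a constant that is continuous in `s`, gives a
series that converges on `Re s > -1` as soon as `∑ y^{-ρ}` converges for `ρ > 2`. -/
theorem locallyDominatedOn_of_rpow {ι : Type*} {F : ι → ℂ → ℂ} {y : ι → ℝ} {B : ℂ → ℝ}
    (hy : ∀ ρ : ℝ, 2 < ρ → Summable fun i => y i ^ (-ρ)) (hy1 : ∀ᶠ i in cofinite, 1 ≤ y i)
    (hB : Continuous B)
    (hF : ∀ᶠ i in cofinite, ∀ s ∈ halfPlane, ‖F i s‖ ≤ B s * y i ^ (-s.re - 3)) :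
    LocallyDominatedOn F halfPlane := by
  intro K hK hK'
  rcases K.eq_empty_or_nonempty with rfl | hne
  · exact ⟨0, summable_zero, by simp⟩
  obtain ⟨s₀, hs₀, hmin⟩ := hK'.exists_isMinOn hne Complex.continuous_re.continuousOn
  obtain ⟨C, hC⟩ := (hK'.image hB).bddAbove
  have hpos : -1 < s₀.re := hK hs₀
  refine ⟨fun i => |C| * y i ^ (-(s₀.re + 3)), (hy _ (by linarith)).mul_left _, ?_⟩
  filter_upwards [hF, hy1] with i hi h1 s hs
  have h2 : s₀.re ≤ s.re := hmin hs
  have h3 : B s ≤ |C| := (hC ⟨s, hs, rfl⟩).trans (le_abs_self C)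
  refine (hi s (hK hs)).trans ?_
  have h4 : y i ^ (-s.re - 3) ≤ y i ^ (-(s₀.re + 3)) :=
    Real.rpow_le_rpow_of_exponent_le h1 (by linarith)
  have h5 : 0 ≤ y i ^ (-s.re - 3) := Real.rpow_nonneg (by linarith) _
  gcongr

/-! ### The lattice points `k τ + l` -/

/-- The lattice point `k τ + l`. -/
def latPt (τ : ℝ) (r : ℕ × ℕ) : ℝ := r.1 * τ + r.2

theorem latPt_nonneg {τ : ℝ} (hτ : 0 < τ) (r : ℕ × ℕ) : 0 ≤ latPt τ r := by
  unfold latPt; positivity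

theorem latPt_pos {τ : ℝ} (hτ : 0 < τ) {r : ℕ × ℕ} (hr : r ≠ (0, 0)) : 0 < latPt τ r := by
  obtain ⟨k, l⟩ := r
  unfold latPt
  rcases Nat.eq_zero_or_pos k with rfl | hk
  · have : 0 < l := Nat.pos_of_ne_zero fun h => hr (by simp [h])
    simpa using this
  · have : (0:ℝ) < k := by exact_mod_cast hk
    positivity

theorem eventually_le_latPt {τ : ℝ} (hτ : 0 < τ) (c : ℝ) :
    ∀ᶠ r in cofinite, c ≤ latPt τ r := by
  obtain ⟨N, hN⟩ := exists_nat_gt (max c (c / τ))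
  refine (Finset.finite_toSet (Finset.range N ×ˢ Finset.range N)).subset fun r hr => ?_
  simp only [Set.mem_compl_iff, Set.mem_ofPred_eq, not_le] at hr
  unfold latPt at hr
  have h1 : (r.1 : ℝ) * τ < c := by
    have : (0:ℝ) ≤ r.2 := Nat.cast_nonneg _
    linarith
  have h2 : (r.2 : ℝ) < c := by
    have : (0:ℝ) ≤ r.1 * τ := by positivity
    linarith
  have h3 : (r.1 : ℝ) < N := ((lt_div_iff₀ hτ).2 h1).trans ((le_max_right _ _).trans_lt hN)
  have h4 : (r.2 : ℝ) < N := h2.trans ((le_max_left _ _).trans_lt hN)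
  simp only [Finset.coe_product, Set.mem_prod, Finset.coe_range, Set.mem_Iio]
  exact ⟨by exact_mod_cast h3, by exact_mod_cast h4⟩

/-- By the inequality between the arithmetic and the geometric mean, the lattice sum is dominated by
a product of two one-dimensional sums. -/
theorem summable_latPt_rpow {τ : ℝ} (hτ : 0 < τ) {ρ : ℝ} (hρ : 2 < ρ) :
    Summable fun r : ℕ × ℕ => latPt τ r ^ (-ρ) := by
  have h1 : Summable fun k : ℕ => ((k : ℝ) + 1) ^ (-(ρ / 2)) := by
    have := (summable_nat_add_iff 1).2 (Real.summable_nat_rpow.2 (by linarith : -(ρ / 2) < -1))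
    simpa using this
  have h2 := h1.mul_of_nonneg h1 (fun k => by positivity) (fun k => by positivity)
  -- `(k + 1) τ + (l + 1)` is comparable to `k τ + l` away from the origin.
  set m := min τ 1 with hm
  have hm0 : 0 < m := lt_min hτ one_pos
  set c := m / (m + 2 + 2 * τ) with hc
  have hc0 : 0 < c := by positivity
  refine Summable.of_norm_bounded (h2.mul_left ((c * √τ) ^ (-ρ))) fun r => ?_
  rw [Real.norm_of_nonneg (Real.rpow_nonneg (latPt_nonneg hτ r) _)]
  by_cases hr : r = (0, 0)
  · rw [hr, latPt]
    simp only [Nat.cast_zero, zero_mul, add_zero]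
    rw [Real.zero_rpow (by linarith)]
    positivity
  have hk : (0:ℝ) ≤ r.1 := Nat.cast_nonneg _
  have hl : (0:ℝ) ≤ r.2 := Nat.cast_nonneg _
  have hmL : m ≤ latPt τ r := by
    unfold latPt
    have : 1 ≤ r.1 ∨ 1 ≤ r.2 := by
      by_contra! h
      exact hr (Prod.ext (by simpa using h.1) (by simpa using h.2))
    rcases this with h | h
    · have h' : (1:ℝ) ≤ r.1 := by exact_mod_cast h
      have := min_le_left τ 1
      nlinarith
    · have h' : (1:ℝ) ≤ r.2 := by exact_mod_cast h
      have := min_le_right τ 1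
      nlinarith
  have hle : c * (((r.1 : ℝ) + 1) * τ + (r.2 + 1)) ≤ latPt τ r := by
    rw [hc, div_mul_eq_mul_div, div_le_iff₀ (by positivity)]
    have : ((r.1 : ℝ) + 1) * τ + (r.2 + 1) = latPt τ r + (τ + 1) := by unfold latPt; ring
    rw [this]
    nlinarith
  have hag : √τ * (((r.1 : ℝ) + 1) * (r.2 + 1)) ^ (1 / 2 : ℝ) ≤
      ((r.1 : ℝ) + 1) * τ + (r.2 + 1) := by
    rw [← Real.sqrt_eq_rpow, ← Real.sqrt_mul hτ.le, Real.sqrt_le_left (by positivity)]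
    have e1 : 0 ≤ ((r.1 : ℝ) + 1) * τ := by positivity
    nlinarith [sq_nonneg (((r.1 : ℝ) + 1) * τ - (r.2 + 1)), mul_nonneg e1 (by linarith : 0 ≤ (r.2 : ℝ) + 1)]
  have hfin : c * √τ * (((r.1 : ℝ) + 1) * (r.2 + 1)) ^ (1 / 2 : ℝ) ≤ latPt τ r :=
    le_trans (by rw [mul_assoc]; gcongr) hle
  refine (Real.rpow_le_rpow_of_nonpos (by positivity) hfin (by linarith)).trans (le_of_eq ?_)
  rw [Real.mul_rpow (by positivity) (by positivity), ← Real.rpow_mul (by positivity),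
    ← Real.mul_rpow (by positivity) (by positivity)]
  congr 2
  ring

/-! ### Lattice sums of the remainders -/

/-- The sum of the Euler-Maclaurin remainders over the lattice points `k τ + l`, `k ≥ 1`. -/
def emSum (τ : ℝ) (s : ℂ) : ℂ := ∑' r : ℕ × ℕ, emRem s (latPt τ (r.1 + 1, r.2))

theorem latPt_succ_pos {τ : ℝ} (hτ : 0 < τ) (r : ℕ × ℕ) : 0 < latPt τ (r.1 + 1, r.2) :=
  latPt_pos hτ (by simp)

theorem injective_succ_fst : Function.Injective fun r : ℕ × ℕ => (r.1 + 1, r.2) := by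
  rintro ⟨a, b⟩ ⟨c, d⟩ h
  simpa using h

theorem locallyDominatedOn_emRem {τ : ℝ} (hτ : 0 < τ) :
    LocallyDominatedOn (fun (r : ℕ × ℕ) s => emRem s (latPt τ (r.1 + 1, r.2))) halfPlane := by
  refine locallyDominatedOn_of_rpow (y := fun r => latPt τ (r.1 + 1, r.2))
    (B := fun s => ‖s * (s + 1) * (s + 2)‖)
    (fun ρ hρ => (summable_latPt_rpow hτ hρ).comp_injective injective_succ_fst)
    (injective_succ_fst.tendsto_cofinite.eventually (eventually_le_latPt hτ 1))
    (by fun_prop) (Eventually.of_forall fun r s hs => ?_)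
  have hs' : -1 < s.re := hs
  exact norm_emRem_le (latPt_succ_pos hτ r) (by linarith)

theorem summable_emRem {τ : ℝ} (hτ : 0 < τ) {s : ℂ} (hs : -1 < s.re) :
    Summable fun r : ℕ × ℕ => emRem s (latPt τ (r.1 + 1, r.2)) :=
  (locallyDominatedOn_emRem hτ).summable hs

theorem differentiableOn_emSum {τ : ℝ} (hτ : 0 < τ) : DifferentiableOn ℂ (emSum τ) halfPlane :=
  (locallyDominatedOn_emRem hτ).differentiableOn isOpen_halfPlane fun r =>
    (differentiable_emRem (latPt_succ_pos hτ r)).differentiableOn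

/-- The term of the lattice sum of the Taylor remainders, `0` at the origin. -/
def taylorTerm (τ : ℝ) (z : ℂ) (r : ℕ × ℕ) (s : ℂ) : ℂ :=
  if r = (0, 0) then 0 else taylorRem z s (latPt τ r)

theorem taylorTerm_origin (τ : ℝ) (z : ℂ) : taylorTerm τ z (0, 0) = fun _ => 0 := by
  ext s
  simp [taylorTerm]

/-- The sum of the Taylor remainders of `z ↦ (z + Ω)^{-s}` over the lattice points `Ω ≠ 0`. -/
def taylorSum (τ : ℝ) (z : ℂ) (s : ℂ) : ℂ := ∑' r : ℕ × ℕ, taylorTerm τ z r s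

theorem locallyDominatedOn_taylorTerm {τ : ℝ} (hτ : 0 < τ) (z : ℂ) :
    LocallyDominatedOn (taylorTerm τ z) halfPlane := by
  refine locallyDominatedOn_of_rpow (y := fun r => latPt τ r / 2)
    (B := fun s => ‖s * (s + 1) * (s + 2)‖ * ‖z‖ ^ 3 * Real.exp (Real.pi * |s.im|))
    (fun ρ hρ => ?_) ?_ (by fun_prop) ?_
  · refine ((summable_latPt_rpow hτ hρ).mul_right ((1 / 2) ^ (-ρ))).congr fun r => ?_
    rw [← Real.mul_rpow (latPt_nonneg hτ r) (by norm_num), mul_one_div]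
  · filter_upwards [eventually_le_latPt hτ 2] with r hr
    linarith
  · filter_upwards [eventually_le_latPt hτ (2 * ‖z‖), eventually_le_latPt hτ 2] with r hr hr2 s hs
    have hs' : -1 < s.re := hs
    have hr0 : r ≠ (0, 0) := by
      rintro rfl
      norm_num [latPt] at hr2
    rw [taylorTerm, if_neg hr0]
    refine (norm_taylorRem_le (by linarith) hr (by linarith)).trans (le_of_eq ?_)
    ring

theorem differentiable_taylorTerm {τ : ℝ} (hτ : 0 < τ) {z : ℂ}
    (hz : ∀ r, z + latPt τ r ≠ 0) (r : ℕ × ℕ) : Differentiable ℂ (taylorTerm τ z r) := by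
  by_cases hr : r = (0, 0)
  · rw [hr, taylorTerm_origin]
    exact differentiable_const 0
  have hΩ : (latPt τ r : ℂ) ≠ 0 := by exact_mod_cast (latPt_pos hτ hr).ne'
  have e : taylorTerm τ z r = fun s => taylorRem z s (latPt τ r) := by
    ext s
    rw [taylorTerm, if_neg hr]
  rw [e]
  unfold taylorRem
  have h0 : Differentiable ℂ fun s : ℂ => (z + latPt τ r) ^ (-s) :=
    differentiable_id.neg.const_cpow (Or.inl (hz r))
  have h1 : Differentiable ℂ fun s : ℂ => (latPt τ r : ℂ) ^ (-s) :=
    differentiable_id.neg.const_cpow (Or.inl hΩ)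
  have h2 : Differentiable ℂ fun s : ℂ => (latPt τ r : ℂ) ^ (-s - 1) :=
    (differentiable_id.neg.sub_const 1).const_cpow (Or.inl hΩ)
  have h3 : Differentiable ℂ fun s : ℂ => (latPt τ r : ℂ) ^ (-s - 2) :=
    (differentiable_id.neg.sub_const 2).const_cpow (Or.inl hΩ)
  fun_prop

theorem differentiableOn_taylorSum {τ : ℝ} (hτ : 0 < τ) {z : ℂ} (hz : ∀ r, z + latPt τ r ≠ 0) :
    DifferentiableOn ℂ (taylorSum τ z) halfPlane :=
  (locallyDominatedOn_taylorTerm hτ z).differentiableOn isOpen_halfPlane fun r =>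
    (differentiable_taylorTerm hτ hz r).differentiableOn

theorem taylorSum_zero (τ : ℝ) (z : ℂ) : taylorSum τ z 0 = 0 := by
  rw [taylorSum, ← tsum_zero (α := ℂ) (β := ℕ × ℕ)]
  congr 1
  ext r
  simp [taylorTerm, taylorRem]

theorem deriv_taylorTerm_zero {τ : ℝ} (hτ : 0 < τ) {z : ℂ} (hz : ∀ r, z + latPt τ r ≠ 0)
    (r : ℕ × ℕ) : deriv (taylorTerm τ z r) 0 =
      if r = (0, 0) then 0 else
        -(Complex.log (z + latPt τ r) - Complex.log (latPt τ r) - z / latPt τ r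
          + z ^ 2 / (2 * latPt τ r ^ 2)) := by
  by_cases hr : r = (0, 0)
  · simp [hr, taylorTerm_origin]
  have hΩ : (latPt τ r : ℂ) ≠ 0 := by exact_mod_cast (latPt_pos hτ hr).ne'
  have e : taylorTerm τ z r = fun s => taylorRem z s (latPt τ r) := by
    ext s
    rw [taylorTerm, if_neg hr]
  rw [e, if_neg hr]
  unfold taylorRem
  have hid := hasDerivAt_id (0 : ℂ)
  have h0 := hid.neg.const_cpow (c := z + latPt τ r) (Or.inl (hz r))
  have h1 := hid.neg.const_cpow (c := (latPt τ r : ℂ)) (Or.inl hΩ)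
  have h2 := (hid.neg.sub_const 1).const_cpow (c := (latPt τ r : ℂ)) (Or.inl hΩ)
  have h3 := (hid.neg.sub_const 2).const_cpow (c := (latPt τ r : ℂ)) (Or.inl hΩ)
  have := ((h0.sub h1).add ((hid.mul_const z).mul h2)).sub
    ((((hid.mul (hid.add_const 1)).div_const 2).mul_const (z ^ 2)).mul h3)
  refine this.deriv.trans ?_
  simp [Complex.cpow_neg_one, cpow_neg_two_eq]
  field_simp
  ring

/-- The derivative at `0` of the sum of the Taylor remainders is the negative logarithm of the
canonical product of genus two over the lattice. -/
theorem hasSum_deriv_taylorSum_zero {τ : ℝ} (hτ : 0 < τ) {z : ℂ} (hz : ∀ r, z + latPt τ r ≠ 0) :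
    HasSum (fun r => if r = (0, 0) then 0 else
        -(Complex.log (z + latPt τ r) - Complex.log (latPt τ r) - z / latPt τ r
          + z ^ 2 / (2 * latPt τ r ^ 2))) (deriv (taylorSum τ z) 0) := by
  have h := (locallyDominatedOn_taylorTerm hτ z).hasSum_deriv isOpen_halfPlane
    (fun r => (differentiable_taylorTerm hτ hz r).differentiableOn) (s := 0) (by simp [halfPlane])
  simp only [deriv_taylorTerm_zero hτ hz] at h
  exact h

/-! ### The lattice zeta function -/

/-- The entire function `(s - 1) ζ(s)`. -/
def zetaReg : ℂ → ℂ := Function.update (fun s => (s - 1) * riemannZeta s) 1 1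

theorem zetaReg_one : zetaReg 1 = 1 := by simp [zetaReg]

theorem zetaReg_of_ne {s : ℂ} (hs : s ≠ 1) : zetaReg s = (s - 1) * riemannZeta s := by
  simp [zetaReg, hs]

/-- This is the expansion `ζ(s) = 1 / (s - 1) + γ + o(1)`. -/
theorem hasDerivAt_zetaReg_one : HasDerivAt zetaReg Real.eulerMascheroniConstant 1 := by
  rw [hasDerivAt_iff_tendsto_slope]
  refine tendsto_riemannZeta_sub_one_div.congr' ?_
  filter_upwards [self_mem_nhdsWithin] with s hs
  have hs' : s ≠ 1 := hs
  have : s - 1 ≠ 0 := sub_ne_zero.2 hs'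
  rw [slope_def_field, zetaReg_one, zetaReg_of_ne hs']
  field_simp

theorem differentiable_zetaReg : Differentiable ℂ zetaReg := by
  intro s
  by_cases hs : s = 1
  · rw [hs]
    exact hasDerivAt_zetaReg_one.differentiableAt
  · refine DifferentiableAt.congr_of_eventuallyEq
      (((differentiableAt_id.sub_const 1).mul (differentiableAt_riemannZeta hs))) ?_
    filter_upwards [isOpen_ne.mem_nhds hs] with w hw
    exact zetaReg_of_ne hw

theorem zetaReg_zero : zetaReg 0 = 1 / 2 := by
  rw [zetaReg_of_ne zero_ne_one, riemannZeta_zero]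
  norm_num

theorem hasDerivAt_zetaReg_zero :
    HasDerivAt zetaReg (-(1 / 2) + (Real.log (2 * Real.pi) : ℂ) / 2) 0 := by
  have h := ((hasDerivAt_id (0 : ℂ)).sub_const 1).mul
    (differentiableAt_riemannZeta (s := 0) zero_ne_one).hasDerivAt
  refine (h.congr_of_eventuallyEq ?_).congr_deriv ?_
  · filter_upwards [isOpen_ne.mem_nhds (zero_ne_one : (0 : ℂ) ≠ 1)] with w hw
    exact zetaReg_of_ne hw
  · rw [riemannZeta_zero, deriv_riemannZeta_zero, Complex.ofReal_log Real.two_pi_pos.le]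
    push_cast
    simp
    ring

/-- The function `(s - 1) (s - 2) χ(s; τ, 1)`, where `χ(s; τ, 1)` is the sum of `Ω^{-s}` over the
lattice points `Ω ≠ 0`. It is holomorphic on `Re s > -1`, since `χ` has at most simple poles at `1`
and `2`. -/
def latNum (τ : ℝ) (s : ℂ) : ℂ :=
  (s - 2) * zetaReg s * (1 + (τ : ℂ) ^ (-s) / 2) + (τ : ℂ) ^ (1 - s) * zetaReg (s - 1) +
    (s - 1) * (s - 2) * ((τ : ℂ) ^ (-s - 1) * zetaReg (s + 1) / 12 + emSum τ s)

theorem differentiableOn_latNum {τ : ℝ} (hτ : 0 < τ) :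
    DifferentiableOn ℂ (latNum τ) halfPlane := by
  have h0 : (τ : ℂ) ≠ 0 := by exact_mod_cast hτ.ne'
  have h1 : DifferentiableOn ℂ (fun s : ℂ => (τ : ℂ) ^ (-s)) halfPlane :=
    (differentiable_id.neg.const_cpow (Or.inl h0)).differentiableOn
  have h2 : DifferentiableOn ℂ (fun s : ℂ => (τ : ℂ) ^ (1 - s)) halfPlane :=
    ((differentiable_id.const_sub 1).const_cpow (Or.inl h0)).differentiableOn
  have h3 : DifferentiableOn ℂ (fun s : ℂ => (τ : ℂ) ^ (-s - 1)) halfPlane :=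
    ((differentiable_id.neg.sub_const 1).const_cpow (Or.inl h0)).differentiableOn
  have z0 : DifferentiableOn ℂ (fun s : ℂ => zetaReg s) halfPlane :=
    differentiable_zetaReg.differentiableOn
  have z1 : DifferentiableOn ℂ (fun s : ℂ => zetaReg (s - 1)) halfPlane :=
    (differentiable_zetaReg.comp (differentiable_id.sub_const 1)).differentiableOn
  have z2 : DifferentiableOn ℂ (fun s : ℂ => zetaReg (s + 1)) halfPlane :=
    (differentiable_zetaReg.comp (differentiable_id.add_const 1)).differentiableOn
  have hS := differentiableOn_emSum hτ
  unfold latNum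
  fun_prop

/-- The summand of the lattice zeta function, `0` at the origin. -/
def latTerm (τ : ℝ) (s : ℂ) (r : ℕ × ℕ) : ℂ :=
  if r = (0, 0) then 0 else (latPt τ r : ℂ) ^ (-s)

theorem summable_latTerm {τ : ℝ} (hτ : 0 < τ) {s : ℂ} (hs : 2 < s.re) :
    Summable (latTerm τ s) := by
  refine Summable.of_norm_bounded (summable_latPt_rpow hτ hs) fun r => ?_
  unfold latTerm
  split_ifs with h
  · rw [norm_zero]
    exact Real.rpow_nonneg (latPt_nonneg hτ r) _
  · rw [Complex.norm_cpow_eq_rpow_re_of_pos (latPt_pos hτ h)]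
    simp

theorem hasSum_riemannZeta {s : ℂ} (hs : 1 < s.re) :
    HasSum (fun k : ℕ => (((k : ℝ) + 1 : ℝ) : ℂ) ^ (-s)) (riemannZeta s) := by
  have h1 : Summable fun k : ℕ => 1 / ((k : ℂ) + 1) ^ s := by
    have := (summable_nat_add_iff 1).2 (Complex.summable_one_div_nat_cpow.2 hs)
    simpa using this
  rw [zeta_eq_tsum_one_div_nat_add_one_cpow hs]
  convert h1.hasSum using 2 with k
  rw [Complex.cpow_neg, one_div]
  simp

/-- The main part of the Euler-Maclaurin expansion of `∑ (x + l)^{-s}`. -/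
def emMain (s : ℂ) (x : ℝ) : ℂ :=
  (x : ℂ) ^ (1 - s) / (s - 1) + (x : ℂ) ^ (-s) / 2 + s / 12 * (x : ℂ) ^ (-s - 1)

theorem tendsto_ofReal_add_nat_cpow (x : ℝ) {c : ℂ} (hc : c.re < 0) :
    Tendsto (fun n : ℕ => ((x + n : ℝ) : ℂ) ^ c) atTop (nhds 0) := by
  have hx : Tendsto (fun n : ℕ => x + n) atTop atTop :=
    tendsto_atTop_add_const_left _ _ tendsto_natCast_atTop_atTop
  rw [tendsto_zero_iff_norm_tendsto_zero]
  have h := (tendsto_rpow_neg_atTop (y := -c.re) (by linarith)).comp hx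
  refine h.congr' ?_
  filter_upwards [hx.eventually_gt_atTop 0] with n hn
  rw [Complex.norm_cpow_eq_rpow_re_of_pos hn]
  simp

/-- The Euler-Maclaurin formula for the Hurwitz zeta function: the main parts telescope and vanish at
infinity. -/
theorem tsum_add_nat_cpow {s : ℂ} (hs : 2 < s.re) {x : ℝ}
    (h1 : Summable fun l : ℕ => ((x + l : ℝ) : ℂ) ^ (-s))
    (h2 : Summable fun l : ℕ => emRem s (x + l)) :
    ∑' l : ℕ, ((x + l : ℝ) : ℂ) ^ (-s) = emMain s x + ∑' l : ℕ, emRem s (x + l) := by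
  have hs1 : s ≠ 1 := by
    rintro rfl
    norm_num at hs
  rw [← sub_eq_iff_eq_add, ← h1.tsum_sub h2]
  have hpart : ∀ n : ℕ, ∑ l ∈ Finset.range n, (((x + l : ℝ) : ℂ) ^ (-s) - emRem s (x + l)) =
      emMain s x - emMain s (x + n) := by
    intro n
    induction n with
    | zero => simp
    | succ n ih =>
      rw [Finset.sum_range_succ, ih, emRem_of_ne hs1, emMain, emMain, emMain]
      push_cast
      rw [← add_assoc]
      ring
  have hlim : Tendsto (fun n : ℕ => emMain s (x + n)) atTop (nhds 0) := by
    have a := tendsto_ofReal_add_nat_cpow x (c := 1 - s) (by simp; linarith)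
    have b := tendsto_ofReal_add_nat_cpow x (c := -s) (by simp; linarith)
    have c := tendsto_ofReal_add_nat_cpow x (c := -s - 1) (by simp; linarith)
    simpa [emMain] using ((a.div_const (s - 1)).add (b.div_const 2)).add (c.const_mul (s / 12))
  have := (h1.sub h2).hasSum.tendsto_sum_nat
  simp only [hpart] at this
  simpa using tendsto_nhds_unique this (hlim.const_sub (emMain s x))

/-- The row `k = 0` gives `ζ(s)`. In the row `k ≥ 1` the Hurwitz zeta function at `k τ` is expanded
by the Euler-Maclaurin formula; the sum of the main parts over `k` is a combination of `ζ(s - 1)`,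
`ζ(s)` and `ζ(s + 1)`. -/
theorem tsum_latTerm {τ : ℝ} (hτ : 0 < τ) {s : ℂ} (hs : 2 < s.re) :
    ∑' r, latTerm τ s r = latNum τ s / ((s - 1) * (s - 2)) := by
  have hsum := summable_latTerm hτ hs
  have hem := summable_emRem hτ (s := s) (by linarith)
  have e0 : ∀ k l : ℕ, latPt τ (k + 1, l) = (k + 1) * τ + l := by
    intro k l
    simp [latPt]
  have hcol : ∀ k l : ℕ, latTerm τ s (k + 1, l) = (((k + 1) * τ + l : ℝ) : ℂ) ^ (-s) := by
    intro k l
    rw [latTerm, if_neg (by simp), e0]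
  have hrow : ∑' l : ℕ, latTerm τ s (0, l) = riemannZeta s := by
    have hs0 : Summable fun l : ℕ => latTerm τ s (0, l) := hsum.prod_factor 0
    rw [hs0.tsum_eq_zero_add, ← (hasSum_riemannZeta (by linarith : 1 < s.re)).tsum_eq]
    simp [latTerm, latPt]
  have hem' : ∀ k : ℕ, Summable fun l : ℕ => emRem s ((k + 1) * τ + l) := by
    intro k
    simpa only [e0] using hem.prod_factor k
  have hk : ∀ k : ℕ, ∑' l : ℕ, latTerm τ s (k + 1, l) =
      emMain s ((k + 1) * τ) + ∑' l : ℕ, emRem s ((k + 1) * τ + l) := by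
    intro k
    have hs1 : Summable fun l : ℕ => latTerm τ s (k + 1, l) := hsum.prod_factor (k + 1)
    simp only [hcol] at hs1 ⊢
    exact tsum_add_nat_cpow hs hs1 (hem' k)
  have hmain : HasSum (fun k : ℕ => emMain s ((k + 1) * τ))
      ((τ : ℂ) ^ (1 - s) * riemannZeta (s - 1) / (s - 1) + (τ : ℂ) ^ (-s) * riemannZeta s / 2
        + s / 12 * ((τ : ℂ) ^ (-s - 1) * riemannZeta (s + 1))) := by
    have a := (hasSum_riemannZeta (s := s - 1) (by simp; linarith)).mul_left ((τ : ℂ) ^ (1 - s))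
    have b := (hasSum_riemannZeta (s := s) (by linarith)).mul_left ((τ : ℂ) ^ (-s))
    have c := (hasSum_riemannZeta (s := s + 1) (by simp; linarith)).mul_left ((τ : ℂ) ^ (-s - 1))
    refine (((a.div_const (s - 1)).add (b.div_const 2)).add (c.mul_left (s / 12))).congr_fun
      fun k => ?_
    have hm : ∀ c : ℂ, (((k + 1) * τ : ℝ) : ℂ) ^ c = (τ : ℂ) ^ c * (((k : ℝ) + 1 : ℝ) : ℂ) ^ c := by
      intro c
      rw [mul_comm, Complex.ofReal_mul, Complex.mul_cpow_ofReal_nonneg hτ.le (by positivity)]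
    rw [emMain, hm, hm, hm, neg_sub, neg_add']
  have hemk : HasSum (fun k : ℕ => ∑' l : ℕ, emRem s ((k + 1) * τ + l)) (emSum τ s) := by
    have := hem.hasSum.prod_fiberwise fun k => (hem.prod_factor k).hasSum
    simpa only [emSum, e0] using this
  have hs1 : s - 1 ≠ 0 := sub_ne_zero.2 (by rintro rfl; norm_num at hs)
  have hs2 : s - 2 ≠ 0 := sub_ne_zero.2 (by rintro rfl; norm_num at hs)
  have hs0 : s + 1 ≠ 1 := fun h => by
    have : s = 0 := by simpa using h
    rw [this] at hs
    norm_num at hs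
  have hs3 : s - 1 ≠ 1 := fun h => hs2 (by linear_combination h)
  rw [hsum.tsum_prod, hsum.prod.tsum_eq_zero_add, hrow]
  simp only [hk]
  rw [(hmain.add hemk).tsum_eq, latNum, zetaReg_of_ne (sub_ne_zero.1 hs1), zetaReg_of_ne hs0,
    zetaReg_of_ne hs3]
  field_simp
  ring

/-! ### Values and derivatives of the numerator at `1` and `2` -/

theorem latNum_one {τ : ℝ} (hτ : 0 < τ) : latNum τ 1 = -(1 + τ) / (2 * τ) := by
  have h0 : (τ : ℂ) ≠ 0 := by exact_mod_cast hτ.ne'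
  simp [latNum, zetaReg_one, zetaReg_zero, Complex.cpow_neg_one]
  field_simp
  ring

theorem latNum_two {τ : ℝ} (hτ : 0 < τ) : latNum τ 2 = 1 / τ := by
  have h0 : (τ : ℂ) ≠ 0 := by exact_mod_cast hτ.ne'
  have e : (2 - 1 : ℂ) = 1 := by norm_num
  have e' : (1 - 2 : ℂ) = -1 := by norm_num
  simp [latNum, e, e', zetaReg_one, Complex.cpow_neg_one]

theorem hasDerivAt_latNum {τ : ℝ} (hτ : 0 < τ) {s : ℂ} (hs : s ∈ halfPlane) {d0 d1 : ℂ}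
    (h0 : HasDerivAt zetaReg d0 s) (h1 : HasDerivAt zetaReg d1 (s - 1)) :
    HasDerivAt (latNum τ)
      ((zetaReg s + (s - 2) * d0) * (1 + (τ : ℂ) ^ (-s) / 2)
        - (s - 2) * zetaReg s * (Real.log τ * (τ : ℂ) ^ (-s) / 2)
        + ((τ : ℂ) ^ (1 - s) * d1 - Real.log τ * (τ : ℂ) ^ (1 - s) * zetaReg (s - 1))
        + (2 * s - 3) * ((τ : ℂ) ^ (-s - 1) * zetaReg (s + 1) / 12 + emSum τ s)
        + (s - 1) * (s - 2) *
          deriv (fun s => (τ : ℂ) ^ (-s - 1) * zetaReg (s + 1) / 12 + emSum τ s) s) s := by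
  have ht : (τ : ℂ) ≠ 0 := by exact_mod_cast hτ.ne'
  have hid := hasDerivAt_id s
  have p0 := hid.neg.const_cpow (c := (τ : ℂ)) (Or.inl ht)
  have p1 := (hid.const_sub 1).const_cpow (c := (τ : ℂ)) (Or.inl ht)
  have p2 : DifferentiableAt ℂ (fun s : ℂ => (τ : ℂ) ^ (-s - 1)) s :=
    ((differentiable_id.neg.sub_const 1).const_cpow (Or.inl ht)) s
  have z2 : DifferentiableAt ℂ (fun s : ℂ => zetaReg (s + 1)) s :=
    (differentiable_zetaReg.comp (differentiable_id.add_const 1)) s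
  have hS : DifferentiableAt ℂ (emSum τ) s :=
    (differentiableOn_emSum hτ).differentiableAt (isOpen_halfPlane.mem_nhds hs)
  have hlast : DifferentiableAt ℂ
    (fun s => (τ : ℂ) ^ (-s - 1) * zetaReg (s + 1) / 12 + emSum τ s) s := by fun_prop
  have h1' : HasDerivAt (fun s => zetaReg (s - 1)) d1 s :=
    (HasDerivAt.comp s h1 (hid.sub_const 1)).congr_deriv (mul_one d1)
  have := ((((hid.sub_const 2).mul h0).mul ((p0.div_const 2).const_add 1)).add (p1.mul h1')).add
    (((hid.sub_const 1).mul (hid.sub_const 2)).mul hlast.hasDerivAt)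
  refine this.congr_deriv ?_
  rw [Complex.ofReal_log hτ.le]
  simp
  ring

theorem hasDerivAt_latNum_one {τ : ℝ} (hτ : 0 < τ) :
    HasDerivAt (latNum τ) ((1 + τ) / (2 * τ) - Real.eulerMascheroniConstant * (1 + 1 / (2 * τ))
      + Real.log τ / (2 * τ) - Real.log τ / 2 + Real.log (2 * Real.pi) / 2
      - riemannZeta 2 / (12 * τ ^ 2) - emSum τ 1) 1 := by
  have ht : (τ : ℂ) ≠ 0 := by exact_mod_cast hτ.ne'
  have h := hasDerivAt_latNum hτ (s := 1) (by simp [halfPlane]) hasDerivAt_zetaReg_one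
    (by simpa using hasDerivAt_zetaReg_zero)
  refine h.congr_deriv ?_
  have e1 : (-1 - 1 : ℂ) = -2 := by norm_num
  have e2 : (1 + 1 : ℂ) = 2 := by norm_num
  rw [e1, e2, zetaReg_one, zetaReg_of_ne (by norm_num : (2 : ℂ) ≠ 1)]
  simp [zetaReg_zero, Complex.cpow_neg_one, cpow_neg_two_eq]
  field_simp
  ring

theorem hasDerivAt_latNum_two {τ : ℝ} (hτ : 0 < τ) :
    HasDerivAt (latNum τ) (riemannZeta 2 * (1 + 1 / (2 * τ ^ 2))
      + (Real.eulerMascheroniConstant - Real.log τ) / τ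
      + riemannZeta 3 / (6 * τ ^ 3) + emSum τ 2) 2 := by
  have ht : (τ : ℂ) ≠ 0 := by exact_mod_cast hτ.ne'
  have e0 : (2 - 1 : ℂ) = 1 := by norm_num
  have h := hasDerivAt_latNum hτ (s := 2) (by simp [halfPlane]; norm_num)
    (differentiable_zetaReg 2).hasDerivAt (by rw [e0]; exact hasDerivAt_zetaReg_one)
  refine h.congr_deriv ?_
  have e1 : (-2 - 1 : ℂ) = -3 := by norm_num
  have e2 : (2 + 1 : ℂ) = 3 := by norm_num
  have e3 : (1 - 2 : ℂ) = -1 := by norm_num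
  rw [e0, e1, e2, e3, zetaReg_one, zetaReg_of_ne (by norm_num : (2 : ℂ) ≠ 1),
    zetaReg_of_ne (by norm_num : (3 : ℂ) ≠ 1)]
  simp [Complex.cpow_neg_one, cpow_neg_two_eq, cpow_neg_three_eq]
  field_simp
  ring

/-! ### The digamma function and Stirling's formula on the positive half-line -/

theorem hasDerivAt_log_Gamma {x : ℝ} (hx : 0 < x) :
    HasDerivAt (fun x => Real.log (Real.Gamma x)) (psiReal x) x := by
  have h := (Real.differentiableAt_Gamma fun m => by
    have : (0:ℝ) ≤ m := Nat.cast_nonneg m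
    linarith).hasDerivAt (x := x)
  exact h.log (Real.Gamma_pos_of_pos hx).ne'

theorem log_Gamma_add_one {x : ℝ} (hx : 0 < x) :
    Real.log (Real.Gamma (x + 1)) = Real.log (Real.Gamma x) + Real.log x := by
  rw [Real.Gamma_add_one hx.ne', Real.log_mul hx.ne' (Real.Gamma_pos_of_pos hx).ne', add_comm]

theorem psiReal_add_one {x : ℝ} (hx : 0 < x) : psiReal (x + 1) = psiReal x + 1 / x := by
  have h1 : HasDerivAt (fun x => Real.log (Real.Gamma (x + 1))) (psiReal (x + 1)) x := by
    simpa using (hasDerivAt_log_Gamma (by linarith : 0 < x + 1)).comp_add_const x 1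
  have h2 := (hasDerivAt_log_Gamma hx).add (Real.hasDerivAt_log hx.ne')
  rw [one_div]
  refine h1.unique (h2.congr_of_eventuallyEq ?_)
  filter_upwards [lt_mem_nhds hx] with y hy
  exact log_Gamma_add_one hy

/-- By convexity of `log Γ`, its slope on `[x, x + 1]` bounds the derivative at `x` from above; the
slope is `log x` by the functional equation. -/
theorem psiReal_le_log {x : ℝ} (hx : 0 < x) : psiReal x ≤ Real.log x := by
  have h := Real.convexOn_log_Gamma.le_slope_of_hasDerivAt (x := x) (y := x + 1) hx
    (by simp; linarith) (by linarith) (hasDerivAt_log_Gamma hx)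
  simpa [slope_def_field, log_Gamma_add_one hx] using h

theorem log_le_psiReal {x : ℝ} (hx : 0 < x) : Real.log x ≤ psiReal (x + 1) := by
  have h := Real.convexOn_log_Gamma.slope_le_of_hasDerivAt (x := x) (y := x + 1) hx
    (by simp; linarith) (by linarith) (hasDerivAt_log_Gamma (by linarith))
  simpa [slope_def_field, log_Gamma_add_one hx] using h

theorem tendsto_log_add_one_sub_log :
    Tendsto (fun x : ℝ => Real.log (x + 1) - Real.log x) atTop (nhds 0) := by
  have h : Tendsto (fun x : ℝ => Real.log (1 + x⁻¹)) atTop (nhds 0) := by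
    have := (tendsto_inv_atTop_zero (𝕜 := ℝ)).const_add 1
    rw [add_zero] at this
    have h2 := (Real.continuousAt_log one_ne_zero).tendsto.comp this
    rwa [Real.log_one] at h2
  refine h.congr' ?_
  filter_upwards [eventually_gt_atTop 0] with x hx
  rw [← Real.log_div (by linarith) hx.ne']
  congr 1
  field_simp

theorem tendsto_psiReal_sub_log :
    Tendsto (fun x => psiReal x - Real.log x) atTop (nhds 0) := by
  have h := (tendsto_log_add_one_sub_log.comp (tendsto_atTop_add_const_right atTop (-1 : ℝ)
    tendsto_id)).neg
  rw [neg_zero] at h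
  refine tendsto_of_tendsto_of_tendsto_of_le_of_le' h tendsto_const_nhds ?_ ?_
  · filter_upwards [eventually_gt_atTop 1] with x hx
    have := log_le_psiReal (x := x - 1) (by linarith)
    simp only [sub_add_cancel] at this
    simp [← sub_eq_add_neg]
    linarith
  · filter_upwards [eventually_gt_atTop 0] with x hx
    have := psiReal_le_log hx
    linarith

theorem psiReal_add_nat {x : ℝ} (hx : 0 < x) (n : ℕ) :
    psiReal (x + n) = psiReal x + ∑ l ∈ Finset.range n, 1 / (x + l) := by
  induction n with
  | zero => simp
  | succ n ih =>
    rw [Finset.sum_range_succ, Nat.cast_succ, ← add_assoc, psiReal_add_one (by positivity), ih]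
    ring

theorem tendsto_add_nat_atTop (x : ℝ) : Tendsto (fun n : ℕ => x + n) atTop atTop :=
  tendsto_atTop_add_const_left _ _ tendsto_natCast_atTop_atTop

theorem tendsto_one_div_add_nat_pow (x : ℝ) {m : ℕ} (hm : m ≠ 0) :
    Tendsto (fun n : ℕ => 1 / (x + n) ^ m) atTop (nhds 0) := by
  simp only [one_div]
  exact ((tendsto_pow_atTop hm).comp (tendsto_add_nat_atTop x)).inv_tendsto_atTop

theorem tendsto_one_div_add_nat (x : ℝ) :
    Tendsto (fun n : ℕ => 1 / (x + n)) atTop (nhds 0) := by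
  simpa using tendsto_one_div_add_nat_pow x one_ne_zero

/-- The Euler-Maclaurin remainders at `s = 1` add up to the error of the expansion
`ψ(x) ∼ log x - 1/(2x) - 1/(12x²)`. -/
theorem tsum_emRem_one {x : ℝ} (hx : 0 < x) (hs : Summable fun l : ℕ => emRem 1 (x + l)) :
    ∑' l : ℕ, emRem 1 (x + l) =
      ((-psiReal x + Real.log x - 1 / (2 * x) - 1 / (12 * x ^ 2) : ℝ) : ℂ) := by
  refine tendsto_nhds_unique hs.hasSum.tendsto_sum_nat ?_
  have hpart : ∀ n : ℕ, ∑ l ∈ Finset.range n, emRem 1 (x + l) =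
      (((psiReal (x + n) - Real.log (x + n)) - psiReal x + Real.log x
        - (1 / x - 1 / (x + n)) / 2 - 1 / 12 * (1 / x ^ 2 - 1 / (x + n) ^ 2) : ℝ) : ℂ) := by
    intro n
    rw [psiReal_add_nat hx]
    induction n with
    | zero => simp
    | succ n ih =>
      rw [Finset.sum_range_succ, ih, emRem_one (by positivity), ← Complex.ofReal_add,
        Finset.sum_range_succ, Nat.cast_succ, ← add_assoc]
      congr 1
      ring_nf
  simp only [hpart]
  refine (Complex.continuous_ofReal.tendsto _).comp ?_
  have h := ((((tendsto_psiReal_sub_log.comp (tendsto_add_nat_atTop x)).sub_const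
    (psiReal x)).add_const (Real.log x)).sub
    (((tendsto_one_div_add_nat x).const_sub (1 / x)).div_const 2)).sub
    (((tendsto_one_div_add_nat_pow x two_ne_zero).const_sub (1 / x ^ 2)).const_mul (1 / 12))
  refine (congrArg (fun c => Tendsto _ atTop (nhds c)) ?_).mpr h
  ring

/-- The partial fraction expansion of the digamma function. -/
theorem tsum_eq_psiReal_sub {x : ℝ} (hx : 0 < x)
    (hs : Summable fun l : ℕ => 1 / (1 + (l : ℝ)) - 1 / (x + l)) :
    ∑' l : ℕ, (1 / (1 + (l : ℝ)) - 1 / (x + l)) = psiReal x - psiReal 1 := by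
  refine tendsto_nhds_unique hs.hasSum.tendsto_sum_nat ?_
  have e : ∀ n : ℕ, ∑ l ∈ Finset.range n, (1 / (1 + (l : ℝ)) - 1 / (x + l)) =
      (psiReal (1 + n) - Real.log (1 + n)) - (psiReal (x + n) - Real.log (x + n))
        + (Real.log (1 + n) - Real.log (x + n)) + (psiReal x - psiReal 1) := by
    intro n
    rw [psiReal_add_nat hx, psiReal_add_nat one_pos, Finset.sum_sub_distrib]
    ring
  simp only [e]
  have hl : Tendsto (fun n : ℕ => Real.log (1 + n) - Real.log (x + n)) atTop (nhds 0) := by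
    have h1 : Tendsto (fun n : ℕ => 1 + (1 - x) * (1 / (x + n))) atTop (nhds 1) := by
      simpa using ((tendsto_one_div_add_nat x).const_mul (1 - x)).const_add 1
    have h2 := (Real.continuousAt_log one_ne_zero).tendsto.comp h1
    rw [Real.log_one] at h2
    refine h2.congr fun n => ?_
    have h3 : 0 < x + n := by positivity
    rw [← Real.log_div (by positivity) h3.ne']
    simp only [Function.comp]
    congr 1
    field_simp
    ring
  have := ((((tendsto_psiReal_sub_log.comp (tendsto_add_nat_atTop 1)).sub
    (tendsto_psiReal_sub_log.comp (tendsto_add_nat_atTop x)))).add hl).add_const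
    (psiReal x - psiReal 1)
  simpa using this

theorem summable_one_div_add_nat_sq {x : ℝ} (hx : 0 < x) :
    Summable fun l : ℕ => 1 / (x + l) ^ 2 := by
  have h : Summable fun l : ℕ => 1 / (l : ℝ) ^ 2 := Real.summable_one_div_nat_pow.2 (by norm_num)
  refine Summable.of_norm_bounded_eventually_nat h ?_
  filter_upwards [eventually_gt_atTop 0] with l hl
  have : (0:ℝ) < l := by exact_mod_cast hl
  rw [Real.norm_of_nonneg (by positivity)]
  gcongr
  linarith

theorem hasDerivAt_psiReal {x : ℝ} (hx : 0 < x) :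
    HasDerivAt psiReal (∑' l : ℕ, 1 / (x + l) ^ 2) x := by
  have hd : ∀ (l : ℕ) (y : ℝ), 0 < y →
      HasDerivAt (fun y => 1 / (1 + (l : ℝ)) - 1 / (y + l)) (1 / (y + l) ^ 2) y := by
    intro l y hy
    have h0 : y + l ≠ 0 := by positivity
    have := (((hasDerivAt_id y).add_const (l : ℝ)).inv h0).const_sub (1 / (1 + (l : ℝ)))
    refine (this.congr_of_eventuallyEq (Eventually.of_forall fun y => ?_)).congr_deriv ?_
    · simp [one_div]
    · simp [neg_div]
  set t := Set.Ioi (min x 1 / 2) with ht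
  have hm : 0 < min x 1 := lt_min hx one_pos
  have hxt : x ∈ t := by
    have := min_le_left x 1
    simp only [ht, Set.mem_Ioi]
    linarith
  have h1t : (1 : ℝ) ∈ t := by
    have := min_le_right x 1
    simp only [ht, Set.mem_Ioi]
    linarith
  have hpos : ∀ y ∈ t, 0 < y := fun y hy => (half_pos hm).trans hy
  have hb : ∀ (l : ℕ) (y : ℝ), y ∈ t → ‖1 / (y + l) ^ 2‖ ≤ 1 / (min x 1 / 2 + l) ^ 2 := by
    intro l y hy
    have := hpos y hy
    have hy' : min x 1 / 2 < y := hy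
    rw [Real.norm_of_nonneg (by positivity)]
    gcongr
  have hs1 : Summable fun l : ℕ => 1 / (1 + (l : ℝ)) - 1 / (1 + l) := by simp
  have hsum : ∀ y ∈ t, Summable fun l : ℕ => 1 / (1 + (l : ℝ)) - 1 / (y + l) := fun y hy =>
    summable_of_summable_hasDerivAt_of_isPreconnected
      (g := fun (l : ℕ) (y : ℝ) => 1 / (1 + (l : ℝ)) - 1 / (y + l))
      (g' := fun (l : ℕ) (y : ℝ) => 1 / (y + l) ^ 2) (y₀ := 1)
      (summable_one_div_add_nat_sq (half_pos hm)) isOpen_Ioi isPreconnected_Ioi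
      (fun l y hy => hd l y (hpos y hy)) hb h1t hs1 hy
  have key := hasDerivAt_tsum_of_isPreconnected
      (g := fun (l : ℕ) (y : ℝ) => 1 / (1 + (l : ℝ)) - 1 / (y + l))
      (g' := fun (l : ℕ) (y : ℝ) => 1 / (y + l) ^ 2) (y₀ := 1)
    (summable_one_div_add_nat_sq (half_pos hm)) isOpen_Ioi isPreconnected_Ioi
      (fun l y hy => hd l y (hpos y hy)) hb h1t hs1 hxt
  refine (key.add_const (psiReal 1)).congr_of_eventuallyEq ?_
  filter_upwards [isOpen_Ioi.mem_nhds hxt] with y hy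
  rw [tsum_eq_psiReal_sub (hpos y hy) (hsum y hy)]
  ring

/-- The Euler-Maclaurin remainders at `s = 2` add up to the error of the expansion
`ψ'(x) ∼ 1/x + 1/(2x²) + 1/(6x³)`. -/
theorem tsum_emRem_two {x : ℝ} (hx : 0 < x) (hs : Summable fun l : ℕ => emRem 2 (x + l)) :
    ∑' l : ℕ, emRem 2 (x + l) =
      ((deriv psiReal x - 1 / x - 1 / (2 * x ^ 2) - 1 / (6 * x ^ 3) : ℝ) : ℂ) := by
  refine tendsto_nhds_unique hs.hasSum.tendsto_sum_nat ?_
  have hpart : ∀ n : ℕ, ∑ l ∈ Finset.range n, emRem 2 (x + l) =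
      ((∑ l ∈ Finset.range n, 1 / (x + l) ^ 2 - (1 / x - 1 / (x + n))
        - (1 / x ^ 2 - 1 / (x + n) ^ 2) / 2 - 1 / 6 * (1 / x ^ 3 - 1 / (x + n) ^ 3) : ℝ) : ℂ) := by
    intro n
    induction n with
    | zero => simp
    | succ n ih =>
      rw [Finset.sum_range_succ, ih, emRem_two, ← Complex.ofReal_add,
        Finset.sum_range_succ, Nat.cast_succ, ← add_assoc]
      congr 1
      ring
  simp only [hpart]
  refine (Complex.continuous_ofReal.tendsto _).comp ?_
  have h := (((summable_one_div_add_nat_sq hx).hasSum.tendsto_sum_nat.sub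
    ((tendsto_one_div_add_nat x).const_sub (1 / x))).sub
    (((tendsto_one_div_add_nat_pow x two_ne_zero).const_sub (1 / x ^ 2)).div_const 2)).sub
    (((tendsto_one_div_add_nat_pow x three_ne_zero).const_sub (1 / x ^ 3)).const_mul (1 / 6))
  rw [(hasDerivAt_psiReal hx).deriv]
  refine (congrArg (fun c => Tendsto _ atTop (nhds c)) ?_).mpr h
  ring

/-- The difference between `log Γ` and its Stirling approximation, up to a constant. -/
def stirlingErr (x : ℝ) : ℝ := Real.log (Real.Gamma x) - (x - 1 / 2) * Real.log x + x

theorem tendsto_stirlingErr_nat :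
    Tendsto (fun n : ℕ => stirlingErr n) atTop (nhds (Real.log (2 * Real.pi) / 2)) := by
  have h := (Real.continuousAt_log (Real.sqrt_pos.2 Real.pi_pos).ne').tendsto.comp
    Stirling.tendsto_stirlingSeq_sqrt_pi
  have h2 := h.add_const (Real.log 2 / 2)
  rw [Real.log_sqrt Real.pi_pos.le] at h2
  rw [Real.log_mul two_ne_zero Real.pi_pos.ne', add_div, add_comm]
  refine h2.congr' ?_
  filter_upwards [eventually_gt_atTop 0] with n hn
  have hn' : (0:ℝ) < n := by exact_mod_cast hn
  have hG := log_Gamma_add_one hn'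
  rw [Real.Gamma_nat_eq_factorial] at hG
  simp only [Function.comp, Stirling.log_stirlingSeq_formula, stirlingErr]
  rw [hG, Real.log_mul two_ne_zero hn'.ne', Real.log_div hn'.ne' (Real.exp_pos 1).ne', Real.log_exp]
  ring

/-- Stirling's formula; the derivative of the error term tends to `0`, which reduces the claim to
the integers. -/
theorem tendsto_stirlingErr : Tendsto stirlingErr atTop (nhds (Real.log (2 * Real.pi) / 2)) := by
  have hd : ∀ x : ℝ, 0 < x →
      HasDerivAt stirlingErr (psiReal x - Real.log x + 1 / (2 * x)) x := by
    intro x hx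
    have := ((hasDerivAt_log_Gamma hx).sub (((hasDerivAt_id x).sub_const (1 / 2)).mul
      (Real.hasDerivAt_log hx.ne'))).add (hasDerivAt_id x)
    refine this.congr_deriv ?_
    simp
    field_simp
    ring
  have hz : Tendsto (fun x : ℝ => psiReal x - Real.log x + 1 / (2 * x)) atTop (nhds 0) := by
    have := tendsto_psiReal_sub_log.add ((tendsto_inv_atTop_zero (𝕜 := ℝ)).div_const 2)
    simp only [zero_div, add_zero] at this
    refine this.congr fun x => ?_
    rw [inv_eq_one_div, div_div, mul_comm x]
  have hfl : Tendsto (fun x : ℝ => stirlingErr ⌊x⌋₊) atTop (nhds (Real.log (2 * Real.pi) / 2)) :=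
    tendsto_stirlingErr_nat.comp tendsto_nat_floor_atTop
  have hdiff : Tendsto (fun x : ℝ => stirlingErr x - stirlingErr ⌊x⌋₊) atTop (nhds 0) := by
    rw [Metric.tendsto_atTop]
    intro ε hε
    obtain ⟨A, hA⟩ := Metric.tendsto_atTop.1 hz (ε / 2) (half_pos hε)
    refine ⟨max A 0 + 2, fun x hx => ?_⟩
    have hA1 := le_max_left A 0
    have hA2 := le_max_right A 0
    have hx0 : 0 ≤ x := by linarith
    have f1 := Nat.floor_le hx0
    have f2 := Nat.lt_floor_add_one x
    have := Convex.norm_image_sub_le_of_norm_hasDerivWithin_le (f := stirlingErr) (C := ε / 2)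
      (s := Set.Icc (⌊x⌋₊ : ℝ) x)
      (fun y hy => (hd y (by linarith [hy.1])).hasDerivWithinAt)
      (fun y hy => by
        have := hA y (by linarith [hy.1])
        rw [dist_zero_right] at this
        exact this.le)
      (convex_Icc _ _) (Set.left_mem_Icc.2 f1) (Set.right_mem_Icc.2 f1)
    rw [dist_zero_right]
    have h3 : ‖x - (⌊x⌋₊ : ℝ)‖ ≤ 1 := by
      rw [Real.norm_of_nonneg (by linarith)]
      linarith
    nlinarith
  simpa using hdiff.add hfl

/-! ### The gamma modular forms as Laurent coefficients of the lattice zeta function -/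

/-- The value `ζ(m)` as the real limit of the partial sums. -/
theorem exists_real_zeta_nat {m : ℕ} (hm : 1 < m) :
    ∃ z : ℝ, (z : ℂ) = riemannZeta m ∧
      Tendsto (fun n : ℕ => ∑ k ∈ Finset.range n, 1 / ((k : ℝ) + 1) ^ m) atTop (nhds z) := by
  have h := hasSum_riemannZeta (s := m) (by simpa using hm)
  have e : ∀ k : ℕ, (((k : ℝ) + 1 : ℝ) : ℂ) ^ (-(m : ℂ)) = ((1 / ((k : ℝ) + 1) ^ m : ℝ) : ℂ) := by
    intro k
    rw [Complex.cpow_neg, Complex.cpow_natCast]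
    simp
  simp only [e] at h
  have hs : Summable fun k : ℕ => 1 / ((k : ℝ) + 1) ^ m := Complex.summable_ofReal.1 h.summable
  refine ⟨_, ?_, hs.hasSum.tendsto_sum_nat⟩
  rw [Complex.ofReal_tsum, h.tsum_eq]

/-- The double sum of the remainders is the sum of its rows, if these are real. -/
theorem exists_real_emSum {τ : ℝ} (hτ : 0 < τ) {s : ℂ} (hs : -1 < s.re) {e : ℕ → ℝ}
    (he : ∀ k : ℕ, (Summable fun l : ℕ => emRem s ((k + 1) * τ + l)) →
      ∑' l : ℕ, emRem s ((k + 1) * τ + l) = (e k : ℂ)) :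
    ∃ E : ℝ, (E : ℂ) = emSum τ s ∧ HasSum e E := by
  have hem := summable_emRem hτ hs
  have e0 : ∀ k l : ℕ, latPt τ (k + 1, l) = (k + 1) * τ + l := by
    intro k l
    simp [latPt]
  have hf : ∀ k : ℕ, Summable fun l : ℕ => emRem s ((k + 1) * τ + l) := by
    intro k
    simpa only [e0] using hem.prod_factor k
  have h := hem.hasSum.prod_fiberwise fun k => (hem.prod_factor k).hasSum
  simp only [e0] at h
  simp only [fun k => he k (hf k)] at h
  have hs : Summable e := Complex.summable_ofReal.1 h.summable
  refine ⟨_, ?_, hs.hasSum⟩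
  rw [Complex.ofReal_tsum, h.tsum_eq]
  simp only [emSum, e0]

theorem sum_Ico_one_succ (f : ℝ → ℝ) (n : ℕ) :
    ∑ k ∈ Finset.Ico 1 (n + 1), f k = ∑ k ∈ Finset.range n, f (k + 1) := by
  rw [Finset.sum_Ico_eq_sum_range]
  simp [add_comm]

theorem harmonic_cast_eq (n : ℕ) :
    ((harmonic n : ℚ) : ℝ) = ∑ k ∈ Finset.range n, 1 / ((k : ℝ) + 1) := by
  simp [harmonic]

theorem sum_log_add_one (n : ℕ) :
    ∑ k ∈ Finset.range n, Real.log ((k : ℝ) + 1) = Real.log (Real.Gamma (n + 1)) := by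
  induction n with
  | zero => simp
  | succ n ih =>
    rw [Finset.sum_range_succ, ih, Nat.cast_succ, log_Gamma_add_one (x := (n : ℝ) + 1)
      (by positivity)]

theorem tendsto_succ_mul_atTop {τ : ℝ} (hτ : 0 < τ) :
    Tendsto (fun n : ℕ => ((n : ℝ) + 1) * τ) atTop atTop :=
  (tendsto_atTop_add_const_right _ _ tendsto_natCast_atTop_atTop).atTop_mul_const hτ

/-- The sum of `ψ(k τ)` is expressed through the row sums of the remainders; the terms that grow
with `M` cancel by Stirling's formula for `Γ(M)` and `Γ(M τ)`. -/
theorem tendsto_gammaModularC {τ : ℝ} (hτ : 0 < τ) {E z : ℝ}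
    (hE : HasSum (fun k : ℕ => -psiReal ((k + 1) * τ) + Real.log ((k + 1) * τ)
      - 1 / (2 * ((k + 1) * τ)) - 1 / (12 * ((k + 1) * τ) ^ 2)) E)
    (hz : Tendsto (fun n : ℕ => ∑ k ∈ Finset.range n, 1 / ((k : ℝ) + 1) ^ 2) atTop (nhds z)) :
    Tendsto (fun M : ℕ => ∑ k ∈ Finset.Ico 1 M, psiReal (k * τ) + 1 / 2 * psiReal (M * τ)
      - 1 / τ * Real.log (Real.Gamma (M * τ) / Real.sqrt (2 * Real.pi))) atTop
      (nhds (-E + Real.log (2 * Real.pi) / 2 - Real.eulerMascheroniConstant / (2 * τ)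
        - z / (12 * τ ^ 2) + Real.log τ * (1 / (2 * τ) - 1 / 2))) := by
  rw [← tendsto_add_atTop_iff_nat 1]
  have hP := tendsto_psiReal_sub_log.comp (tendsto_succ_mul_atTop hτ)
  have hS := tendsto_stirlingErr.comp (tendsto_succ_mul_atTop hτ)
  have hS1 := tendsto_stirlingErr.comp (tendsto_succ_mul_atTop one_pos)
  have h := ((((hE.tendsto_sum_nat.neg.add hS1).add (hP.const_mul (1 / 2))).sub
    ((hS.sub_const (Real.log (2 * Real.pi) / 2)).const_mul (1 / τ))).sub
    ((Real.tendsto_harmonic_sub_log_add_one.div_const (2 * τ)).add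
      (hz.div_const (12 * τ ^ 2)))).add_const (Real.log τ * (1 / (2 * τ) - 1 / 2))
  refine ((congrArg (fun c => Tendsto _ atTop (nhds c)) ?_).mpr h).congr fun n => ?_
  · ring
  have hm : (0:ℝ) < (n : ℝ) + 1 := by positivity
  have hmt : 0 < ((n : ℝ) + 1) * τ := by positivity
  have e1 : ∑ k ∈ Finset.range n, (-psiReal ((k + 1) * τ) + Real.log ((k + 1) * τ)
      - 1 / (2 * ((k + 1) * τ)) - 1 / (12 * ((k + 1) * τ) ^ 2)) =
      -∑ k ∈ Finset.range n, psiReal ((k + 1) * τ) + (Real.log (Real.Gamma (n + 1))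
        + n * Real.log τ) - (1 / (2 * τ)) * ((harmonic n : ℚ) : ℝ)
        - 1 / (12 * τ ^ 2) * ∑ k ∈ Finset.range n, 1 / ((k : ℝ) + 1) ^ 2 := by
    rw [harmonic_cast_eq, ← sum_log_add_one, Finset.sum_sub_distrib, Finset.sum_sub_distrib,
      Finset.sum_add_distrib, Finset.sum_neg_distrib, Finset.mul_sum, Finset.mul_sum]
    congr 1
    · congr 1
      · congr 1
        have : ∀ k ∈ Finset.range n, Real.log (((k : ℝ) + 1) * τ) =
            Real.log ((k : ℝ) + 1) + Real.log τ := fun k _ =>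
          Real.log_mul (by positivity) hτ.ne'
        rw [Finset.sum_congr rfl this, Finset.sum_add_distrib]
        simp
      · refine Finset.sum_congr rfl fun k _ => ?_
        field_simp
    · refine Finset.sum_congr rfl fun k _ => ?_
      field_simp
  rw [sum_Ico_one_succ fun x => psiReal (x * τ), e1]
  rw [Real.log_div (Real.Gamma_pos_of_pos (by push_cast; exact hmt)).ne'
    (Real.sqrt_pos.2 Real.two_pi_pos).ne', Real.log_sqrt Real.two_pi_pos.le]
  simp only [Function.comp, stirlingErr, Nat.cast_add, Nat.cast_one, mul_one,
    Real.log_mul hm.ne' hτ.ne']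
  field_simp
  ring_nf

/-- `γ - C(τ)` is the finite part at `s = 1` of the lattice zeta function
`latNum τ s / ((s - 1) (s - 2))`. -/
theorem gammaModularC_eq {τ : ℝ} (hτ : 0 < τ) :
    (gammaModularC τ : ℂ) =
      Real.eulerMascheroniConstant + latNum τ 1 + deriv (latNum τ) 1 := by
  have ht : (τ : ℂ) ≠ 0 := by exact_mod_cast hτ.ne'
  obtain ⟨E, hE, hE'⟩ := exists_real_emSum hτ (s := 1) (by simp)
    (fun k hs => tsum_emRem_one (x := (k + 1) * τ) (by positivity) hs)
  obtain ⟨z, hz, hz'⟩ := exists_real_zeta_nat one_lt_two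
  rw [gammaModularC, (tendsto_gammaModularC hτ hE' hz').limUnder_eq, latNum_one hτ,
    (hasDerivAt_latNum_one hτ).deriv, ← hE]
  rw [Nat.cast_ofNat] at hz
  rw [← hz]
  push_cast
  field_simp
  ring

theorem tendsto_gammaModularD {τ : ℝ} (hτ : 0 < τ) {E z z' : ℝ}
    (hE : HasSum (fun k : ℕ => deriv psiReal ((k + 1) * τ) - 1 / ((k + 1) * τ)
      - 1 / (2 * ((k + 1) * τ) ^ 2) - 1 / (6 * ((k + 1) * τ) ^ 3)) E)
    (hz : Tendsto (fun n : ℕ => ∑ k ∈ Finset.range n, 1 / ((k : ℝ) + 1) ^ 2) atTop (nhds z))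
    (hz' : Tendsto (fun n : ℕ => ∑ k ∈ Finset.range n, 1 / ((k : ℝ) + 1) ^ 3) atTop (nhds z')) :
    Tendsto (fun M : ℕ => ∑ k ∈ Finset.Ico 1 M, deriv psiReal (k * τ)
      + 1 / 2 * deriv psiReal (M * τ) - 1 / τ * psiReal (M * τ)) atTop
      (nhds (E + (Real.eulerMascheroniConstant - Real.log τ) / τ + z / (2 * τ ^ 2)
        + z' / (6 * τ ^ 3))) := by
  rw [← tendsto_add_atTop_iff_nat 1]
  have hP := tendsto_psiReal_sub_log.comp (tendsto_succ_mul_atTop hτ)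
  have hinv : ∀ m : ℕ, m ≠ 0 →
      Tendsto (fun n : ℕ => (((n + 1) * τ) ^ m)⁻¹) atTop (nhds 0) := fun m hm =>
    ((tendsto_pow_atTop hm).comp (tendsto_succ_mul_atTop hτ)).inv_tendsto_atTop
  -- The terms of the convergent series `hE` tend to `0`.
  have hd : Tendsto (fun n : ℕ => deriv psiReal ((n + 1) * τ)) atTop (nhds 0) := by
    have h := ((hE.summable.tendsto_atTop_zero.add (hinv 1 one_ne_zero)).add
      ((hinv 2 two_ne_zero).div_const 2)).add ((hinv 3 three_ne_zero).div_const 6)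
    refine ((congrArg (fun c => Tendsto _ atTop (nhds c)) ?_).mpr h).congr fun n => ?_
    · ring
    · field_simp
      ring
  have h := ((((hE.tendsto_sum_nat.add (hd.const_mul (1 / 2))).sub (hP.const_mul (1 / τ))).add
    ((Real.tendsto_harmonic_sub_log_add_one.sub_const (Real.log τ)).div_const τ)).add
    (hz.div_const (2 * τ ^ 2))).add (hz'.div_const (6 * τ ^ 3))
  refine ((congrArg (fun c => Tendsto _ atTop (nhds c)) ?_).mpr h).congr fun n => ?_
  · ring
  have hm : (0:ℝ) < (n : ℝ) + 1 := by positivity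
  have e1 : ∑ k ∈ Finset.range n, (deriv psiReal ((k + 1) * τ) - 1 / ((k + 1) * τ)
      - 1 / (2 * ((k + 1) * τ) ^ 2) - 1 / (6 * ((k + 1) * τ) ^ 3)) =
      ∑ k ∈ Finset.range n, deriv psiReal ((k + 1) * τ) - (1 / τ) * ((harmonic n : ℚ) : ℝ)
        - 1 / (2 * τ ^ 2) * ∑ k ∈ Finset.range n, 1 / ((k : ℝ) + 1) ^ 2
        - 1 / (6 * τ ^ 3) * ∑ k ∈ Finset.range n, 1 / ((k : ℝ) + 1) ^ 3 := by
    rw [harmonic_cast_eq, Finset.sum_sub_distrib, Finset.sum_sub_distrib,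
      Finset.sum_sub_distrib, Finset.mul_sum, Finset.mul_sum, Finset.mul_sum]
    congr 1
    · congr 1
      · congr 1
        refine Finset.sum_congr rfl fun k _ => ?_
        field_simp
      · refine Finset.sum_congr rfl fun k _ => ?_
        field_simp
    · refine Finset.sum_congr rfl fun k _ => ?_
      field_simp
  rw [sum_Ico_one_succ fun x => deriv psiReal (x * τ), e1]
  simp only [Function.comp, Nat.cast_add, Nat.cast_one, Real.log_mul hm.ne' hτ.ne']
  ring

/-- `π² / 6 + D(τ)` is the sum of the residue and the finite part at `s = 2` of the lattice zeta
function `latNum τ s / ((s - 1) (s - 2))`. -/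
theorem gammaModularD_eq {τ : ℝ} (hτ : 0 < τ) :
    (gammaModularD τ : ℂ) = deriv (latNum τ) 2 - Real.pi ^ 2 / 6 := by
  have ht : (τ : ℂ) ≠ 0 := by exact_mod_cast hτ.ne'
  obtain ⟨E, hE, hE'⟩ := exists_real_emSum hτ (s := 2) (by simp; norm_num)
    (fun k hs => tsum_emRem_two (x := (k + 1) * τ) (by positivity) hs)
  obtain ⟨z, hz, hz'⟩ := exists_real_zeta_nat one_lt_two
  obtain ⟨w, hw, hw'⟩ := exists_real_zeta_nat (m := 3) (by norm_num)
  rw [gammaModularD, (tendsto_gammaModularD hτ hE' hz' hw').limUnder_eq,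
    (hasDerivAt_latNum_two hτ).deriv, ← hE, ← riemannZeta_two]
  rw [Nat.cast_ofNat] at hz hw
  rw [← hz, ← hw]
  push_cast
  field_simp
  ring

/-! ### Analytic continuation -/

theorem isOpen_continuationRegion : IsOpen continuationRegion :=
  (isOpen_lt continuous_const Complex.continuous_re).inter
    ((isOpen_ne).inter isOpen_ne)

theorem zero_mem_continuationRegion : (0 : ℂ) ∈ continuationRegion := by
  simp [continuationRegion]

/-- The region is a chain of overlapping convex sets. -/
theorem isPreconnected_continuationRegion : IsPreconnected continuationRegion := by
  have hA : IsPreconnected {s : ℂ | -1 < s.re ∧ 0 < s.im} :=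
    ((convex_halfSpace_re_gt (-1)).inter (convex_halfSpace_im_gt 0)).isPreconnected
  have hB : IsPreconnected {s : ℂ | -1 < s.re ∧ s.im < 0} :=
    ((convex_halfSpace_re_gt (-1)).inter (convex_halfSpace_im_lt 0)).isPreconnected
  have h1 : IsPreconnected {s : ℂ | -1 < s.re ∧ s.re < 1} :=
    ((convex_halfSpace_re_gt (-1)).inter (convex_halfSpace_re_lt 1)).isPreconnected
  have h2 : IsPreconnected {s : ℂ | 1 < s.re ∧ s.re < 2} :=
    ((convex_halfSpace_re_gt 1).inter (convex_halfSpace_re_lt 2)).isPreconnected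
  have h3 : IsPreconnected {s : ℂ | 2 < s.re} := (convex_halfSpace_re_gt 2).isPreconnected
  have key := (((hA.union (Complex.I / 2) (by simp) (by simp) h1).union (-Complex.I / 2)
    (by simp) (by norm_num) hB).union (3 / 2 + Complex.I) (by left; left; norm_num) (by norm_num)
    h2).union (3 + Complex.I) (by left; left; left; norm_num) (by norm_num) h3
  convert key using 1
  ext s
  simp only [continuationRegion, Set.mem_ofPred_eq, Set.mem_union, ne_eq, Complex.ext_iff,
    Complex.one_re, Complex.one_im, Complex.re_ofNat, Complex.im_ofNat]
  constructor
  · rintro ⟨h, h1, h2⟩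
    rcases lt_trichotomy s.im 0 with hi | hi | hi
    · tauto
    · have e1 : s.re ≠ 1 := fun h => h1 ⟨h, hi⟩
      have e2 : s.re ≠ 2 := fun h => h2 ⟨h, hi⟩
      rcases lt_or_gt_of_ne e1 with h3 | h3
      · tauto
      · rcases lt_or_gt_of_ne e2 with h4 | h4 <;> tauto
    · tauto
  · rintro ((((h | h) | h) | h) | h)
    all_goals refine ⟨by linarith, fun h' => ?_, fun h' => ?_⟩ <;> linarith [h'.1, h'.2]

/-- Any explicit continuation computes `analyticContinuation`, by the identity theorem. -/
theorem analyticContinuation_eqOn {f F : ℂ → ℂ} (hF : DifferentiableOn ℂ F continuationRegion)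
    (h : ∀ s : ℂ, 2 < s.re → F s = f s) :
    Set.EqOn (analyticContinuation f) F continuationRegion := by
  have hex : ∃ F : ℂ → ℂ, DifferentiableOn ℂ F continuationRegion ∧
    ∀ s : ℂ, 2 < s.re → F s = f s := ⟨F, hF, h⟩
  rw [analyticContinuation, dif_pos hex]
  obtain ⟨h1, h2⟩ := Classical.choose_spec hex
  refine (h1.analyticOnNhd isOpen_continuationRegion).eqOn_of_preconnected_of_eventuallyEq
    (hF.analyticOnNhd isOpen_continuationRegion) isPreconnected_continuationRegion
    (z₀ := 3) ⟨by norm_num, by norm_num, by norm_num⟩ ?_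
  filter_upwards [(isOpen_lt continuous_const Complex.continuous_re).mem_nhds
    (show (2:ℝ) < (3 : ℂ).re by norm_num)] with s hs
  rw [h2 s hs, h s hs]

theorem deriv_analyticContinuation_zero {f F : ℂ → ℂ}
    (hF : DifferentiableOn ℂ F continuationRegion) (h : ∀ s : ℂ, 2 < s.re → F s = f s) :
    deriv (analyticContinuation f) 0 = deriv F 0 :=
  ((analyticContinuation_eqOn hF h).eventuallyEq_of_mem
    (isOpen_continuationRegion.mem_nhds zero_mem_continuationRegion)).deriv_eq

/-- The continuation of the lattice zeta function. -/
def latZeta (τ : ℝ) (s : ℂ) : ℂ := latNum τ s / ((s - 1) * (s - 2))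

/-- The continuation of `∑ (z + Ω)^{-s} - ∑ Ω^{-s}`, the second sum without `Ω = 0`. With `χ` for
the continued lattice zeta function, it is
`z^{-s} + taylorSum τ z s - s z χ(s + 1) + s (s + 1) / 2 * z² χ(s + 2)`; the factors in `s` cancel the
poles at `s = 0`. -/
def zetaDiff (τ : ℝ) (z s : ℂ) : ℂ :=
  z ^ (-s) + taylorSum τ z s - z * (latNum τ (s + 1) / (s - 1)) + z ^ 2 / 2 * latNum τ (s + 2)

theorem differentiableOn_latZeta {τ : ℝ} (hτ : 0 < τ) :
    DifferentiableOn ℂ (latZeta τ) continuationRegion := by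
  refine ((differentiableOn_latNum hτ).mono fun s hs => hs.1).div (by fun_prop) fun s hs => ?_
  exact mul_ne_zero (sub_ne_zero.2 hs.2.1) (sub_ne_zero.2 hs.2.2)

theorem differentiableOn_latNum_add {τ : ℝ} (hτ : 0 < τ) {c : ℝ} (hc : 0 ≤ c) :
    DifferentiableOn ℂ (fun s => latNum τ (s + c)) halfPlane := by
  refine (differentiableOn_latNum hτ).comp (by fun_prop) fun s hs => ?_
  have : -1 < s.re := hs
  simp only [halfPlane, Set.mem_ofPred_eq, Complex.add_re, Complex.ofReal_re]
  linarith

theorem differentiableOn_zetaDiff {τ : ℝ} (hτ : 0 < τ) {z : ℂ} (hz : ∀ r, z + latPt τ r ≠ 0) :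
    DifferentiableOn ℂ (zetaDiff τ z) continuationRegion := by
  have hz0 : z ≠ 0 := by simpa [latPt] using hz (0, 0)
  have hsub : continuationRegion ⊆ halfPlane := fun s hs => hs.1
  have h0 : DifferentiableOn ℂ (fun s : ℂ => z ^ (-s)) continuationRegion :=
    (differentiable_id.neg.const_cpow (Or.inl hz0)).differentiableOn
  have h1 := (differentiableOn_taylorSum hτ hz).mono hsub
  have h2 : DifferentiableOn ℂ (fun s => latNum τ (s + 1) / (s - 1)) continuationRegion := by
    have := (differentiableOn_latNum_add hτ zero_le_one).mono hsub
    simp only [Complex.ofReal_one] at this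
    exact this.div (by fun_prop) fun s hs => sub_ne_zero.2 hs.2.1
  have h3 := (differentiableOn_latNum_add hτ zero_le_two).mono hsub
  simp only [Complex.ofReal_ofNat] at h3
  exact ((h0.add h1).sub (h2.const_mul z)).add (h3.const_mul (z ^ 2 / 2))

/-- The summand at a lattice point `Ω ≠ 0` is replaced by its Taylor polynomial in `z` and the
remainder; the powers of `Ω` add up to the lattice zeta function at `s`, `s + 1` and `s + 2`. -/
theorem tsum_add_latPt_cpow {τ : ℝ} (hτ : 0 < τ) {z s : ℂ} (hs : 2 < s.re) :
    ∑' r, (z + latPt τ r) ^ (-s) = latZeta τ s + zetaDiff τ z s := by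
  have a0 := (summable_latTerm hτ hs).hasSum
  have a1 := (summable_latTerm hτ (s := s + 1) (by simp; linarith)).hasSum
  have a2 := (summable_latTerm hτ (s := s + 2) (by simp; linarith)).hasSum
  have a3 : HasSum (fun r => taylorTerm τ z r s) (taylorSum τ z s) :=
    ((locallyDominatedOn_taylorTerm hτ z).summable
      (show -1 < s.re by linarith)).hasSum
  have a4 : HasSum (fun r : ℕ × ℕ => if r = (0, 0) then z ^ (-s) else 0) (z ^ (-s)) :=
    hasSum_ite_eq (0, 0) (z ^ (-s))
  rw [tsum_latTerm hτ hs] at a0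
  rw [tsum_latTerm hτ (by simp; linarith)] at a1 a2
  have key := (((a0.add a4).add a3).sub (a1.mul_left (s * z))).add
    (a2.mul_left (s * (s + 1) / 2 * z ^ 2))
  have hs0 : s ≠ 0 := by rintro rfl; norm_num at hs
  have hs1 : s - 1 ≠ 0 := sub_ne_zero.2 (by rintro rfl; norm_num at hs)
  have hs2 : s + 1 ≠ 0 := fun h => by
    rw [eq_neg_of_add_eq_zero_left h] at hs
    norm_num at hs
  refine (HasSum.congr_fun key fun r => ?_).tsum_eq.trans ?_
  · by_cases hr : r = (0, 0)
    · simp [latTerm, taylorTerm, hr, latPt]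
    · simp only [latTerm, taylorTerm, hr, if_false, taylorRem, neg_add']
      ring
  · rw [latZeta, zetaDiff, show s + 1 - 1 = s by ring, show s + 1 - 2 = s - 1 by ring,
      show s + 2 - 1 = s + 1 by ring, show s + 2 - 2 = s by ring]
    field_simp
    ring

theorem zetaDiff_zero {τ : ℝ} (hτ : 0 < τ) (z : ℂ) :
    zetaDiff τ z 0 = 1 - z * (1 + τ) / (2 * τ) + z ^ 2 / (2 * τ) := by
  have ht : (τ : ℂ) ≠ 0 := by exact_mod_cast hτ.ne'
  simp only [zetaDiff, taylorSum_zero, neg_zero, Complex.cpow_zero, zero_add, latNum_one hτ,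
    latNum_two hτ]
  field_simp
  ring

theorem hasDerivAt_zetaDiff_zero {τ : ℝ} (hτ : 0 < τ) {z : ℂ} (hz : ∀ r, z + latPt τ r ≠ 0) :
    HasDerivAt (zetaDiff τ z) (-Complex.log z + deriv (taylorSum τ z) 0
      + z * (latNum τ 1 + deriv (latNum τ) 1) + z ^ 2 / 2 * deriv (latNum τ) 2) 0 := by
  have hz0 : z ≠ 0 := by simpa [latPt] using hz (0, 0)
  have hid := hasDerivAt_id (0 : ℂ)
  have h0 := hid.neg.const_cpow (c := z) (Or.inl hz0)
  have h1 := ((differentiableOn_taylorSum hτ hz).differentiableAt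
    (isOpen_halfPlane.mem_nhds (show (0 : ℂ) ∈ halfPlane by simp [halfPlane]))).hasDerivAt
  have hn : ∀ c : ℂ, c ∈ halfPlane →
      HasDerivAt (fun s => latNum τ (s + c)) (deriv (latNum τ) c) 0 := by
    intro c hc
    have := ((differentiableOn_latNum hτ).differentiableAt
      (isOpen_halfPlane.mem_nhds hc)).hasDerivAt
    refine HasDerivAt.comp_add_const 0 c ?_
    rwa [zero_add]
  have h2 := (hn 1 (by simp [halfPlane])).div (hid.sub_const 1) (by simp)
  have h3 := hn 2 (show (-1:ℝ) < (2 : ℂ).re by norm_num)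
  refine (((h0.add h1).sub (h2.const_mul z)).add (h3.const_mul (z ^ 2 / 2))).congr_deriv ?_
  simp
  ring

/-! ### The double gamma functions -/

theorem ofReal_mul_cpow {x : ℝ} (hx : 0 < x) (w c : ℂ) :
    ((x : ℂ) * w) ^ c = (x : ℂ) ^ c * w ^ c := by
  have hx' : (x : ℂ) ≠ 0 := by exact_mod_cast hx.ne'
  by_cases hw : w = 0
  · by_cases hc : c = 0 <;> simp [hw, hc]
  · rw [Complex.cpow_def_of_ne_zero (mul_ne_zero hx' hw), Complex.cpow_def_of_ne_zero hx',
      Complex.cpow_def_of_ne_zero hw, ← Complex.exp_add, Complex.log_ofReal_mul hx hw,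
      Complex.ofReal_log hx.le]
    ring_nf

theorem latPt_scale {ω₁ : ℝ} (h₁ : 0 < ω₁) (ω₂ : ℝ) (r : ℕ × ℕ) :
    ω₁ * latPt (ω₂ / ω₁) r = r.2 * ω₁ + r.1 * ω₂ := by
  unfold latPt
  field_simp
  ring

/-- The lattice of `(ω₁, ω₂)` is `ω₁` times the lattice of `(1, ω₂ / ω₁)`, so that both zeta functions
acquire the factor `ω₁^{-s}`. -/
theorem deriv_doubleZeta_sub {ω₁ ω₂ : ℝ} (h₁ : 0 < ω₁) (h₂ : 0 < ω₂) {z : ℂ}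
    (hz : ∀ r, z + latPt (ω₂ / ω₁) r ≠ 0) :
    deriv (doubleZeta ω₁ ω₂ (ω₁ * z)) 0 - deriv (latticeZeta ω₁ ω₂) 0 =
      deriv (zetaDiff (ω₂ / ω₁) z) 0 - Real.log ω₁ * zetaDiff (ω₂ / ω₁) z 0 := by
  set τ := ω₂ / ω₁ with hτ'
  have hτ : 0 < τ := div_pos h₂ h₁
  have hω : (ω₁ : ℂ) ≠ 0 := by exact_mod_cast h₁.ne'
  have hp : Differentiable ℂ fun s : ℂ => (ω₁ : ℂ) ^ (-s) :=
    differentiable_id.neg.const_cpow (Or.inl hω)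
  have hL := differentiableOn_latZeta hτ
  have hD := differentiableOn_zetaDiff hτ hz
  have e1 : deriv (doubleZeta ω₁ ω₂ (ω₁ * z)) 0 =
      deriv (fun s => (ω₁ : ℂ) ^ (-s) * (latZeta τ s + zetaDiff τ z s)) 0 := by
    refine deriv_analyticContinuation_zero (hp.differentiableOn.mul (hL.add hD)) fun s hs => ?_
    rw [← tsum_add_latPt_cpow hτ hs, ← tsum_mul_left, ← (Equiv.prodComm ℕ ℕ).tsum_eq]
    refine tsum_congr fun r => ?_
    rw [← ofReal_mul_cpow h₁, mul_add, ← Complex.ofReal_mul, latPt_scale h₁]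
    simp [add_assoc]
  have e2 : deriv (latticeZeta ω₁ ω₂) 0 = deriv (fun s => (ω₁ : ℂ) ^ (-s) * latZeta τ s) 0 := by
    refine deriv_analyticContinuation_zero (hp.differentiableOn.mul hL) fun s hs => ?_
    rw [latZeta, ← tsum_latTerm hτ hs, ← tsum_mul_left, ← (Equiv.prodComm ℕ ℕ).tsum_eq]
    refine tsum_congr fun r => ?_
    have hr : (Equiv.prodComm ℕ ℕ) r = (0, 0) ↔ r = (0, 0) := by
      simp [Prod.ext_iff, and_comm]
    rw [latTerm]
    simp only [hr]
    split_ifs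
    · simp
    · rw [← ofReal_mul_cpow h₁, ← Complex.ofReal_mul, latPt_scale h₁]
      simp
  have h0 := isOpen_continuationRegion.mem_nhds zero_mem_continuationRegion
  have d0 := (hasDerivAt_id (0 : ℂ)).neg.const_cpow (c := (ω₁ : ℂ)) (Or.inl hω)
  have dL := (hL.differentiableAt h0).hasDerivAt
  have dD := (hD.differentiableAt h0).hasDerivAt
  have f1 := (d0.mul (dL.add dD)).deriv
  have f2 := (d0.mul dL).deriv
  rw [e1, e2]
  refine (congrArg₂ (· - ·) f1 f2).trans ?_
  rw [Complex.ofReal_log h₁.le]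
  simp
  ring

/-- The exponent in the relation between the two double gamma functions. -/
def gammaExponent (ω₁ ω₂ : ℝ) (z : ℂ) : ℂ :=
  z / 2 * Real.log (2 * Real.pi) - Real.log ω₂ *
    (1 - z * (1 + ω₂ / ω₁) / (2 * (ω₂ / ω₁)) + z ^ 2 / (2 * (ω₂ / ω₁)))

/-- Away from its zeros, the Weierstrass product is the exponential of a convergent sum. -/
theorem barnesG_eq_exp {τ : ℝ} (hτ : 0 < τ) {z : ℂ} (hz : ∀ r, z + latPt τ r ≠ 0) :
    barnesG z τ = z / τ * Complex.exp (barnesA τ * (z / τ) + barnesB τ * (z ^ 2 / (2 * τ ^ 2))) *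
      Complex.exp (-deriv (taylorSum τ z) 0) := by
  rw [barnesG]
  congr 1
  have h := (hasSum_deriv_taylorSum_zero hτ hz).neg.cexp
  rw [← h.tprod_eq]
  refine tprod_congr fun r => ?_
  have e : (r.1 * τ + r.2 : ℂ) = latPt τ r := by simp [latPt]
  rw [e]
  simp only [Function.comp]
  split_ifs with hr
  · simp
  · have hΩ : (latPt τ r : ℂ) ≠ 0 := by exact_mod_cast (latPt_pos hτ hr).ne'
    -- No branch of the logarithm of the quotient has to be chosen.
    have e2 : 1 + z / latPt τ r = Complex.exp (Complex.log (z + latPt τ r)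
        - Complex.log (latPt τ r)) := by
      rw [Complex.exp_sub, Complex.exp_log (hz r), Complex.exp_log hΩ]
      field_simp
      ring
    rw [e2, ← Complex.exp_add]
    congr 1
    ring

/-- At a lattice point one factor of the product, or the prefactor, vanishes. -/
theorem barnesG_eq_zero {τ : ℝ} (hτ : 0 < τ) {z : ℂ} {r : ℕ × ℕ} (hz : z + latPt τ r = 0) :
    barnesG z τ = 0 := by
  rw [barnesG]
  by_cases hr : r = (0, 0)
  · have : z = 0 := by simpa [hr, latPt] using hz
    simp [this]
  · rw [tprod_of_exists_eq_zero, mul_zero]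
    have hΩ : (latPt τ r : ℂ) ≠ 0 := by exact_mod_cast (latPt_pos hτ hr).ne'
    have e : (r.1 * τ + r.2 : ℂ) = latPt τ r := by simp [latPt]
    refine ⟨r, ?_⟩
    rw [if_neg hr, e, eq_neg_of_add_eq_zero_left hz, neg_div, div_self hΩ]
    simp

/-- The symmetric double gamma function is, up to the exponential of a quadratic polynomial, the
reciprocal of Barnes' double gamma function; this includes the poles, where `Gamma2` is `0` by
convention. -/
theorem Gamma2_eq {ω₁ ω₂ : ℝ} (h₁ : 0 < ω₁) (h₂ : 0 < ω₂) (z : ℂ) :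
    Gamma2 (ω₁ * z) ω₁ ω₂ = Complex.exp (gammaExponent ω₁ ω₂ z) / barnesG z (ω₂ / ω₁) := by
  have hτ : 0 < ω₂ / ω₁ := div_pos h₂ h₁
  have hω : (ω₁ : ℂ) ≠ 0 := by exact_mod_cast h₁.ne'
  have hω2 : (ω₂ : ℂ) ≠ 0 := by exact_mod_cast h₂.ne'
  have hpole : (∃ k l : ℕ, (ω₁ : ℂ) * z = -(k * ω₁ + l * ω₂)) ↔
      ∃ r, z + latPt (ω₂ / ω₁) r = 0 := by
    have e : ∀ r : ℕ × ℕ, (ω₁ : ℂ) * (z + latPt (ω₂ / ω₁) r) =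
        ω₁ * z + (r.2 * ω₁ + r.1 * ω₂) := by
      intro r
      rw [mul_add, ← Complex.ofReal_mul, latPt_scale h₁]
      simp
    constructor
    · rintro ⟨k, l, h⟩
      refine ⟨(l, k), (mul_eq_zero.1 ?_).resolve_left hω⟩
      rw [e, h]
      simp
    · rintro ⟨r, h⟩
      refine ⟨r.2, r.1, eq_neg_of_add_eq_zero_left ?_⟩
      rw [← e, h, mul_zero]
  by_cases hex : ∃ r, z + latPt (ω₂ / ω₁) r = 0
  · rw [Gamma2, if_pos (hpole.2 hex)]
    obtain ⟨r, hr⟩ := hex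
    rw [barnesG_eq_zero hτ hr, div_zero]
  · rw [Gamma2, if_neg (mt hpole.1 hex)]
    push Not at hex
    have hz0 : z ≠ 0 := by simpa [latPt] using hex (0, 0)
    rw [deriv_doubleZeta_sub h₁ h₂ hex, (hasDerivAt_zetaDiff_zero hτ hex).deriv,
      zetaDiff_zero hτ]
    have hzτ : z / ((ω₂ / ω₁ : ℝ) : ℂ) =
        Complex.exp (Complex.log z - (Real.log ω₂ - Real.log ω₁)) := by
      rw [Complex.exp_sub, Complex.exp_sub, Complex.exp_log hz0, ← Complex.ofReal_exp,
        ← Complex.ofReal_exp, Real.exp_log h₁, Real.exp_log h₂]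
      push_cast
      rfl
    have hG : barnesG z (ω₂ / ω₁) = Complex.exp (Complex.log z - (Real.log ω₂ - Real.log ω₁)
        + (barnesA (ω₂ / ω₁) * (z / (ω₂ / ω₁ : ℝ))
          + barnesB (ω₂ / ω₁) * (z ^ 2 / (2 * (ω₂ / ω₁ : ℝ) ^ 2)))
        + -deriv (taylorSum (ω₂ / ω₁) z) 0) := by
      rw [barnesG_eq_exp hτ hex, Complex.exp_add (Complex.log z - _ + _),
        Complex.exp_add (Complex.log z - _), ← hzτ]
    rw [hG, ← Complex.exp_sub]
    congr 1
    have hC := gammaModularC_eq hτ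
    have hD := gammaModularD_eq hτ
    have hY1 : latNum (ω₂ / ω₁) 1 + deriv (latNum (ω₂ / ω₁)) 1 =
        gammaModularC (ω₂ / ω₁) - Real.eulerMascheroniConstant := by
      rw [hC]; ring
    have hY2 : deriv (latNum (ω₂ / ω₁)) 2 = gammaModularD (ω₂ / ω₁) + Real.pi ^ 2 / 6 := by
      rw [hD]; ring
    rw [hY1, hY2, barnesA, barnesB, gammaExponent, Real.log_mul Real.two_pi_pos.ne' hτ.ne',
      Real.log_div h₂.ne' h₁.ne']
    push_cast
    field_simp
    ring

/-! ### The integrands -/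

/-- The first `r - k` entries of a reversed vector are its last `r - k` entries. -/
theorem prod_rev_lt {r : ℕ} (k : ℕ) (hk : k ≤ r) (f : Fin r → ℂ) :
    ∏ j : Fin r with j.val < r - k, f j.rev = ∏ j with k ≤ j.val, f j := by
  refine Finset.prod_equiv Fin.revPerm (fun j => ?_) fun j _ => rfl
  have := j.isLt
  simp [Fin.val_rev]
  omega

theorem prod_rev_ge {r : ℕ} (k : ℕ) (f : Fin r → ℂ) :
    ∏ j : Fin r with r - k ≤ j.val, f j.rev = ∏ j with j.val < k, f j := by
  refine Finset.prod_equiv Fin.revPerm (fun j => ?_) fun j _ => rfl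
  have := j.isLt
  simp [Fin.val_rev]
  omega

theorem card_filter_val_lt {r k : ℕ} (hk : k ≤ r) :
    (Finset.univ.filter fun j : Fin r => j.val < k).card = k := by
  simp [Fin.card_filter_val_lt, hk]

theorem card_filter_le_val {r k : ℕ} (hk : k ≤ r) :
    (Finset.univ.filter fun j : Fin r => k ≤ j.val).card = r - k := by
  have h := Finset.card_filter_add_card_filter_not (s := (Finset.univ : Finset (Fin r)))
    (fun j => j.val < k)
  simp only [not_lt, Finset.card_univ, Fintype.card_fin] at h
  rw [card_filter_val_lt hk] at h
  omega

theorem sum_gammaExponent_sub {ω₁ ω₂ : ℝ} (h₁ : 0 < ω₁) (h₂ : 0 < ω₂) {ι : Type*}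
    (S : Finset ι) (c : ι → ℂ) (s : ℂ) :
    ∑ j ∈ S, gammaExponent ω₁ ω₂ (c j / ω₁ - s) =
      ((∑ j ∈ S, c j) / ω₁ - S.card * s) * (Real.log (2 * Real.pi) / 2
        + Real.log ω₂ * (ω₁ + ω₂) / (2 * ω₂)) - Real.log ω₂ * S.card
      - Real.log ω₂ * ω₁ / (2 * ω₂) * ((∑ j ∈ S, c j ^ 2) / ω₁ ^ 2
        - 2 * s * (∑ j ∈ S, c j) / ω₁ + S.card * s ^ 2) := by
  classical
  have hω : (ω₁ : ℂ) ≠ 0 := by exact_mod_cast h₁.ne'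
  have hω2 : (ω₂ : ℂ) ≠ 0 := by exact_mod_cast h₂.ne'
  induction S using Finset.induction_on with
  | empty => simp
  | insert x S hx ih =>
    rw [Finset.sum_insert hx, ih, Finset.sum_insert hx, Finset.sum_insert hx,
      Finset.card_insert_of_notMem hx, gammaExponent]
    push_cast
    field_simp
    ring

/-- The quadratic polynomial in front of `log ω₂` is invariant under `w ↦ 1 + ω₂ / ω₁ - w`, so that
only the terms with `log (2π)` differ from those in `sum_gammaExponent_sub`. -/
theorem sum_gammaExponent_add {ω₁ ω₂ : ℝ} (h₁ : 0 < ω₁) (h₂ : 0 < ω₂) {ι : Type*}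
    (S : Finset ι) (c : ι → ℂ) (s : ℂ) :
    ∑ j ∈ S, gammaExponent ω₁ ω₂ (1 + (ω₂ / ω₁ : ℝ) - c j / ω₁ + s) =
      S.card * ((ω₁ + ω₂) / (2 * ω₁)) * Real.log (2 * Real.pi)
      + ((∑ j ∈ S, c j) / ω₁ - S.card * s) * (-Real.log (2 * Real.pi) / 2
        + Real.log ω₂ * (ω₁ + ω₂) / (2 * ω₂)) - Real.log ω₂ * S.card
      - Real.log ω₂ * ω₁ / (2 * ω₂) * ((∑ j ∈ S, c j ^ 2) / ω₁ ^ 2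
        - 2 * s * (∑ j ∈ S, c j) / ω₁ + S.card * s ^ 2) := by
  classical
  have hω : (ω₁ : ℂ) ≠ 0 := by exact_mod_cast h₁.ne'
  have hω2 : (ω₂ : ℂ) ≠ 0 := by exact_mod_cast h₂.ne'
  induction S using Finset.induction_on with
  | empty => simp
  | insert x S hx ih =>
    rw [Finset.sum_insert hx, ih, Finset.sum_insert hx, Finset.sum_insert hx,
      Finset.card_insert_of_notMem hx, gammaExponent]
    push_cast
    field_simp
    ring

theorem prod_Gamma2_sub {ω₁ ω₂ : ℝ} (h₁ : 0 < ω₁) (h₂ : 0 < ω₂) {ι : Type*}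
    (S : Finset ι) (c : ι → ℂ) (s : ℂ) :
    ∏ j ∈ S, Gamma2 (c j - ω₁ * s) ω₁ ω₂ =
      Complex.exp (∑ j ∈ S, gammaExponent ω₁ ω₂ (c j / ω₁ - s)) /
        ∏ j ∈ S, barnesG (c j / ω₁ - s) (ω₂ / ω₁) := by
  have hω : (ω₁ : ℂ) ≠ 0 := by exact_mod_cast h₁.ne'
  rw [Complex.exp_sum, ← Finset.prod_div_distrib]
  refine Finset.prod_congr rfl fun j _ => ?_
  rw [← Gamma2_eq h₁ h₂]
  congr 1
  field_simp

theorem prod_Gamma2_add {ω₁ ω₂ : ℝ} (h₁ : 0 < ω₁) (h₂ : 0 < ω₂) {ι : Type*}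
    (S : Finset ι) (c : ι → ℂ) (s : ℂ) :
    ∏ j ∈ S, Gamma2 (ω₁ + ω₂ - c j + ω₁ * s) ω₁ ω₂ =
      Complex.exp (∑ j ∈ S, gammaExponent ω₁ ω₂ (1 + (ω₂ / ω₁ : ℝ) - c j / ω₁ + s)) /
        ∏ j ∈ S, barnesG (1 + (ω₂ / ω₁ : ℝ) - c j / ω₁ + s) (ω₂ / ω₁) := by
  have hω : (ω₁ : ℂ) ≠ 0 := by exact_mod_cast h₁.ne'
  rw [Complex.exp_sum, ← Finset.prod_div_distrib]
  refine Finset.prod_congr rfl fun j _ => ?_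
  rw [← Gamma2_eq h₁ h₂]
  congr 1
  push_cast
  field_simp

theorem constC1_eq_exp {p q : ℕ} (m n : ℕ) (a : Fin p → ℂ) (b : Fin q → ℂ) {ω₁ ω₂ : ℝ}
    (h₂ : 0 < ω₂) : constC1 m n a b ω₁ ω₂ =
      Complex.exp (Real.log (2 * Real.pi) *
          (((ω₁ + ω₂) * (m + n - q) - parNu a b) / (2 * ω₁)) +
        Real.log ω₂ * (-parN p q m n - parXi m n a b / (2 * ω₁ * ω₂)
          + parMu m n a b * (ω₁ + ω₂) / (2 * ω₁ * ω₂))) * ω₁ := by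
  have e1 : ((2 * Real.pi : ℝ) : ℂ) ≠ 0 := by exact_mod_cast Real.two_pi_pos.ne'
  have e2 : (ω₂ : ℂ) ≠ 0 := by exact_mod_cast h₂.ne'
  rw [constC1, Complex.cpow_def_of_ne_zero e1, Complex.cpow_def_of_ne_zero e2,
    ← Complex.ofReal_log Real.two_pi_pos.le, ← Complex.ofReal_log h₂.le, ← Complex.exp_add]

/-- Under `s ↦ ω₁ s` the two integrands agree at every point, up to the constant `C₁ / ω₁`. -/
theorem integrandKtilde_scale {p q : ℕ} (m n : ℕ) (hm : m ≤ q) (hn : n ≤ p)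
    (a : Fin p → ℂ) (b : Fin q → ℂ) {ω₁ ω₂ : ℝ} (h₁ : 0 < ω₁) (h₂ : 0 < ω₂) (α L s : ℂ) :
    integrandKtilde m n a b ω₁ ω₂ α L (ω₁ * s) * ω₁ =
      constC1 m n a b ω₁ ω₂ *
        integrandK (p - n) (q - m) (revScale ω₁ b) (revScale ω₁ a) (ω₂ / ω₁)
          (etaParam p q m n ω₂ α) (logArg m n a b ω₁ ω₂ L) s := by
  have hω : (ω₁ : ℂ) ≠ 0 := by exact_mod_cast h₁.ne'
  have hω2 : (ω₂ : ℂ) ≠ 0 := by exact_mod_cast h₂.ne'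
  have hpi : (Real.pi : ℂ) ≠ 0 := by exact_mod_cast Real.pi_ne_zero
  rw [integrandKtilde, integrandK, calG, constC1_eq_exp m n a b h₂,
    prod_Gamma2_sub h₁ h₂, prod_Gamma2_add h₁ h₂, prod_Gamma2_sub h₁ h₂, prod_Gamma2_add h₁ h₂]
  simp only [revScale]
  rw [prod_rev_lt n hn fun j => barnesG (a j / ω₁ - s) (ω₂ / ω₁),
    prod_rev_lt m hm fun j => barnesG (1 + (ω₂ / ω₁ : ℝ) - b j / ω₁ + s) (ω₂ / ω₁),
    prod_rev_ge n fun j => barnesG (1 + (ω₂ / ω₁ : ℝ) - a j / ω₁ + s) (ω₂ / ω₁),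
    prod_rev_ge m fun j => barnesG (b j / ω₁ - s) (ω₂ / ω₁)]
  set G₁ := ∏ j with j.val < m, barnesG (b j / ω₁ - s) (ω₂ / ω₁)
  set G₂ := ∏ j with j.val < n, barnesG (1 + (ω₂ / ω₁ : ℝ) - a j / ω₁ + s) (ω₂ / ω₁)
  set G₃ := ∏ j with m ≤ j.val, barnesG (1 + (ω₂ / ω₁ : ℝ) - b j / ω₁ + s) (ω₂ / ω₁)
  set G₄ := ∏ j with n ≤ j.val, barnesG (a j / ω₁ - s) (ω₂ / ω₁)
  -- No `Gᵢ` has to be nonzero, since `(x⁻¹)⁻¹ = x` also holds for `x = 0` with the convention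
  -- `0⁻¹ = 0`.
  have key : ∀ x₁ x₂ x₃ x₄ x₅ x₆ y₁ y₂ y₃ : ℂ, x₁ + x₂ - x₃ - x₄ + x₅ + x₆ = y₁ + y₂ + y₃ →
      (Complex.exp x₁ / G₁ * (Complex.exp x₂ / G₂)) /
        (Complex.exp x₃ / G₃ * (Complex.exp x₄ / G₄)) * Complex.exp x₅ * Complex.exp x₆ * ω₁ =
      Complex.exp y₁ * ω₁ * (G₄ * G₃ / (G₂ * G₁) * Complex.exp y₂ * Complex.exp y₃) := by
    intro x₁ x₂ x₃ x₄ x₅ x₆ y₁ y₂ y₃ h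
    have hexp : Complex.exp x₁ * Complex.exp x₂ * (Complex.exp x₃)⁻¹ * (Complex.exp x₄)⁻¹ *
        Complex.exp x₅ * Complex.exp x₆ = Complex.exp y₁ * Complex.exp y₂ * Complex.exp y₃ := by
      rw [← Complex.exp_neg, ← Complex.exp_neg, ← Complex.exp_add, ← Complex.exp_add,
        ← Complex.exp_add, ← Complex.exp_add, ← Complex.exp_add, ← Complex.exp_add,
        ← Complex.exp_add, ← h]
      ring_nf
    simp only [div_eq_mul_inv, mul_inv, inv_inv]
    linear_combination (G₁⁻¹ * G₂⁻¹ * G₃ * G₄ * ω₁) * hexp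
  refine key _ _ _ _ _ _ _ _ _ ?_
  rw [sum_gammaExponent_sub h₁ h₂, sum_gammaExponent_add h₁ h₂, sum_gammaExponent_sub h₁ h₂,
    sum_gammaExponent_add h₁ h₂, card_filter_val_lt hm, card_filter_val_lt hn,
    card_filter_le_val hm, card_filter_le_val hn]
  have hsa : ∑ j, a j = ∑ j with j.val < n, a j + ∑ j with n ≤ j.val, a j := by
    rw [← Finset.sum_filter_add_sum_filter_not Finset.univ (fun j : Fin p => j.val < n)]
    simp
  have hsb : ∑ j, b j = ∑ j with j.val < m, b j + ∑ j with m ≤ j.val, b j := by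
    rw [← Finset.sum_filter_add_sum_filter_not Finset.univ (fun j : Fin q => j.val < m)]
    simp
  rw [etaParam, logArg, logC2, parNu, parMu, parXi, parN, hsa, hsb]
  push_cast [Nat.cast_sub hm, Nat.cast_sub hn]
  field_simp
  ring

/-! ### The contour integrals -/

theorem commonValue_eq_of_isCommonValue {f : ℂ → ℂ} {𝒞 : Set (ℝ → ℂ)} {w : ℂ}
    (h : IsCommonValue f 𝒞 w) : commonValue f 𝒞 = w := by
  have hex : ∃ w, IsCommonValue f 𝒞 w := ⟨w, h⟩
  rw [commonValue, dif_pos hex]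
  obtain ⟨γ, hγ⟩ := h.1
  rw [← ((Classical.choose_spec hex).2 γ hγ).2, (h.2 γ hγ).2]

theorem contour_scale {f g : ℂ → ℂ} {ω C : ℂ} (hC : C ≠ 0)
    (h : ∀ s, f (ω * s) * ω = C * g s) (γ : ℝ → ℂ) :
    (ContourIntegrable f (fun t => ω * γ t) ↔ ContourIntegrable g γ) ∧
      contourMean f (fun t => ω * γ t) = C * contourMean g γ := by
  have e : (fun t : ℝ => f (ω * γ t) * deriv (fun t => ω * γ t) t) =
      fun t => C * (g (γ t) * deriv γ t) := by
    ext t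
    rw [deriv_const_mul_field, ← mul_assoc, h, mul_assoc]
  constructor
  · rw [ContourIntegrable, ContourIntegrable, e]
    exact integrable_const_mul_iff (isUnit_iff_ne_zero.2 hC) _
  · rw [contourMean, contourMean, e, integral_const_mul]
    ring

/-- If no common value exists, both sides are `0` by convention; this uses that `C ≠ 0`. -/
theorem commonValue_scale {f g : ℂ → ℂ} {ω C : ℂ} (hC : C ≠ 0)
    (h : ∀ s, f (ω * s) * ω = C * g s) (P : (ℝ → ℂ) → Prop) :
    commonValue f {δ | ∃ γ, P γ ∧ δ = fun t => ω * γ t} = C * commonValue g {γ | P γ} := by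
  have hiff : ∀ w, IsCommonValue f {δ | ∃ γ, P γ ∧ δ = fun t => ω * γ t} (C * w) ↔
      IsCommonValue g {γ | P γ} w := by
    intro w
    constructor
    · rintro ⟨⟨_, γ, hγ, rfl⟩, h2⟩
      refine ⟨⟨γ, hγ⟩, fun γ' hγ' => ?_⟩
      obtain ⟨h3, h4⟩ := h2 _ ⟨γ', hγ', rfl⟩
      obtain ⟨h5, h6⟩ := contour_scale hC h γ'
      exact ⟨h5.1 h3, mul_left_cancel₀ hC (h6.symm.trans h4)⟩
    · rintro ⟨⟨γ, hγ⟩, h2⟩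
      refine ⟨⟨_, γ, hγ, rfl⟩, ?_⟩
      rintro _ ⟨γ', hγ', rfl⟩
      obtain ⟨h3, h4⟩ := h2 γ' hγ'
      obtain ⟨h5, h6⟩ := contour_scale hC h γ'
      exact ⟨h5.2 h3, by rw [h6, h4]⟩
  by_cases hex : ∃ w, IsCommonValue g {γ | P γ} w
  · obtain ⟨w, hw⟩ := hex
    rw [commonValue_eq_of_isCommonValue hw, commonValue_eq_of_isCommonValue ((hiff w).2 hw)]
  · have hex' : ¬∃ w, IsCommonValue f {δ | ∃ γ, P γ ∧ δ = fun t => ω * γ t} w := by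
      rintro ⟨w, hw⟩
      refine hex ⟨w / C, (hiff _).1 ?_⟩
      rwa [mul_div_cancel₀ _ hC]
    rw [commonValue, commonValue, dif_neg hex, dif_neg hex', mul_zero]

end

theorem mainTheorem12 {p q : ℕ} (m n : ℕ) (hm : m ≤ q) (hn : n ≤ p)
    (a : Fin p → ℂ) (b : Fin q → ℂ) (ω₁ ω₂ : ℝ) (h₁ : 0 < ω₁) (h₂ : 0 < ω₂) (α L : ℂ)
    (hadm : KAdmissible (p - n) (q - m) (revScale ω₁ b) (revScale ω₁ a) (ω₂ / ω₁)
      (etaParam p q m n ω₂ α) (logArg m n a b ω₁ ω₂ L)) :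
    meijerBarnesKtilde m n a b ω₁ ω₂ α L =
        constC1 m n a b ω₁ ω₂ *
          meijerBarnesK (p - n) (q - m) (revScale ω₁ b) (revScale ω₁ a) (ω₂ / ω₁)
            (etaParam p q m n ω₂ α) (logArg m n a b ω₁ ω₂ L) ∧
      ∀ γ : ℝ → ℂ, IsSwappedContour m n a b ω₁ ω₂ α L γ →
        (ContourIntegrable (integrandKtilde m n a b ω₁ ω₂ α L) (fun t => ω₁ * γ t) ↔
          ContourIntegrable
            (integrandK (p - n) (q - m) (revScale ω₁ b) (revScale ω₁ a) (ω₂ / ω₁)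
              (etaParam p q m n ω₂ α) (logArg m n a b ω₁ ω₂ L)) γ) ∧
        contourMean (integrandKtilde m n a b ω₁ ω₂ α L) (fun t => ω₁ * γ t) =
          constC1 m n a b ω₁ ω₂ *
            contourMean
              (integrandK (p - n) (q - m) (revScale ω₁ b) (revScale ω₁ a) (ω₂ / ω₁)
                (etaParam p q m n ω₂ α) (logArg m n a b ω₁ ω₂ L)) γ := by
  have hω : (ω₁ : ℂ) ≠ 0 := by exact_mod_cast h₁.ne'
  have hC : constC1 m n a b ω₁ ω₂ ≠ 0 := by
    rw [constC1_eq_exp m n a b h₂]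
    exact mul_ne_zero (Complex.exp_ne_zero _) hω
  have hf := integrandKtilde_scale m n hm hn a b h₁ h₂ α L
  exact ⟨commonValue_scale hC hf _, fun γ _ => contour_scale hC hf γ⟩
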